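/- **Setting.** Let $T\ge 0$, $d_X^n,d_U^n\ge 0$ and finite mode sets $\mathcal M^n=\{1,\dots,\kappa^n\}$ ($n=0,1$) be given. The system is, for $t=0,\dots,T$, $$X^0_{t+1}=A^{00}(M^0_t)X^0_t+B^{00}(M^0_t)U^0_t+W^0_t,$$ $$X^1_{t+1}=A^{10}(M^{0:1}_t)X^0_t+A^{11}(M^{0:1}_t)X^1_t+B^{10}(M^{0:1}_t)U^0_t+B^{11}(M^{0:1}_t)U^1_t+W^1_t,$$ where $X^n_t,W^n_t\in\mathbb R^{d_X^n}$, $U^n_t\in\mathbb R^{d_U^n}$, $M^n_t\in\mathcal M^n$ and $M^{0:1}_t=(M^0_t,M^1_t)$. The link states $\Gamma_t\in\{0,1\}$ have a law $p$ not depending on $t$, the modes $M^n_t$ have a law $\pi_{M^n}$ not depending on $t$, and $X^n_0\sim\pi_{X^n_0}$, $W^n_t\sim\pi_{W^n_t}$ have finite second moments, $W^n_t$ with mean zero. All the variables $X^n_0,W^n_t,M^n_t,\Gamma_t$ ($n=0,1$, $0\le t\le T$) are independent. The channel outputs are $(Z_t,\tilde Z_t)=(X^1_t,M^1_t)$ if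 $\Gamma_t=1$ and $(\emptyset,\emptyset)$ if $\Gamma_t=0$. The common information is $H^0_t=(X^0_{0:t},M^0_{0:t},Z_{0:t},\tilde Z_{0:t},U^0_{0:t-1})$. The cost is $c_t=X_t^\top Q_t(M^{0:1}_t)X_t+U_t^\top R_t(M^{0:1}_t)U_t$ with $X_t=(X^0_t,X^1_t)$, $U_t=(U^0_t,U^1_t)$, $Q_t(\cdot)$ symmetric positive semidefinite and $R_t(\cdot)$ symmetric positive definite. A prescription strategy $\phi=(\phi^0_t,\phi^1_t)_{0\le t\le T}$ selects, from $h^0_t$, an action $u^0_t=\phi^0_t(h^0_t)\in\mathbb R^{d_U^0}$ and a prescription $\rho_t=\phi^1_t(h^0_t):\mathbb R^{d_X^1}\times\mathcal M^1\to\mathbb R^{d_U^1}$; then $U^0_t=u^0_t$ and $U^1_t=\rho_t(X^1_t,M^1_t)$. It is feasible if $\phi^0_t(h)$ and $[\phi^1_t(h)](x,m)$ are Borel measurable in $h$ and $(h,x,m)$ respectively, and all states and actions $X^n_t$, $U^n_t$ ($0\le t\le T$) have finite second moments. It is optimal if it is feasible and minimizes $\mathbb E\big[\sum_{t=0}^T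 c_t\big]$ among all feasible prescription strategies. Let $\Delta(\mathbb R^d)$ be the set of probability measures on $\mathbb R^d$ with finite second moment, and $\tilde{\mathcal M}^1=\mathcal M^1\cup\{\emptyset\}$. The common belief $\theta_t$ is the conditional distribution of $X^1_t$ given $H^0_t=h^0_t$. Put $\omega^{\emptyset}=\pi_{M^1}$ and $\omega^{l}=\delta_l$ for $l\in\mathcal M^1$. For $u^{prs}=(u^0,\rho)$ let $\psi_t(\theta,u^{prs},x^0,m^0,\tilde z,x^1)=\delta_{x^1}$ for $x^1\in\mathbb R^{d_X^1}$, and let $\psi_t(\theta,u^{prs},x^0,m^0,\tilde z,\emptyset)$ be the law of $$A^{10}(m^0,M)x^0+A^{11}(m^0,M)X+B^{10}(m^0,M)u^0+B^{11}(m^0,M)\rho(X,M)+W$$ for independent $X\sim\theta$, $M\sim\omega^{\tilde z}$, $W\sim\pi_{W^1_t}$. Let $h_2(x^1,m^1)=m^1$ and $$\bar{\mathcal Q}=\{\bar q:\mathcal M^1\to\mathbb R^{d_U^1}\text{ measurable}\},$$ $$\tilde{\mathcal Q}(\theta)=\Big\{\tilde q:\mathbb R^{d_X^1}\times\mathcal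 M^1\to\mathbb R^{d_U^1}\text{ measurable}:\ \tilde q(\cdot,m)\text{ is }\theta\text{-integrable and }\int\tilde q(x,m)\,\theta(dx)=0\ \text{ for all } m\in\mathcal M^1\Big\}.$$ **Theorem.** Suppose there are functions $V_t:\mathbb R^{d_X^0}\times\mathcal M^0\times\Delta(\mathbb R^{d_X^1})\times\tilde{\mathcal M}^1\to\mathbb R$, $t=0,\dots,T+1$, such that $V_{T+1}=0$ and, for all $t=0,\dots,T$ and all $(x^0,m^0,\theta,\tilde z)$, $$V_t(x^0,m^0,\theta,\tilde z)=\min_{u^0\in\mathbb R^{d_U^0},\ \bar q\in\bar{\mathcal Q},\ \tilde q\in\tilde{\mathcal Q}(\theta)}\mathbb E\Big[c_t\big(x^0,X^1_t,m^0,M^1_t,u^0,\rho(X^1_t,M^1_t)\big)+V_{t+1}\big(X^0_{t+1},M^0_{t+1},\psi_t(\theta,u^{prs},x^0,m^0,\tilde z,Z_{t+1}),\tilde Z_{t+1}\big)\Big],$$ where $\rho=\bar q\circ h_2+\tilde q$ and $u^{prs}=(u^0,\rho)$, the minimum being attained. In the expectation, $X^1_t\sim\theta$, $M^1_t\sim\omega^{\tilde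 z}$, $W^{0}_t$, $W^1_t$, $M^{0}_{t+1}$, $M^1_{t+1}$, $\Gamma_{t+1}$ are independent, the last five with their given laws; $X^{0}_{t+1}$, $X^1_{t+1}$ are obtained from the dynamics with $X^0_t=x^0$, $M^0_t=m^0$, $U^0_t=u^0$, $U^1_t=\rho(X^1_t,M^1_t)$; and $(Z_{t+1},\tilde Z_{t+1})$ from the channel. The expectation is taken in $[0,\infty]$ (as a lower integral should $V_{t+1}$ not be measurable, with $V_{t+1}=\infty$ where the updated belief is outside $\Delta$, which happens only if the expected cost is already infinite). Suppose further that $\phi^*$ is a feasible prescription strategy such that, for every $t=0,\dots,T$ and almost every realization $h^0_t$ of the common information under $\phi^*$, with corresponding common belief $\theta_t$, the prescription $\phi^*_t(h^0_t)$ has the form $(u^{0*}_t,\bar q^*_t\circ h_2+\tilde q^*_t)$ with $\bar q^*_t\in\bar{\mathcal Q}$, $\tilde q^*_t\in\tilde{\mathcal Q}(\theta_t)$ and achieves the minimum in the definition of $V_t(x^0_t,m^0_t,\theta_t,\tilde z_t)$. Then $\phi^*$ is an optimal prescription strategy. -/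

import Mathlib

open MeasureTheory ProbabilityTheory
open scoped Matrix ENNReal

noncomputable section

namespace SwitchedNCS

/-- Vectors of `ℝⁿ`. Only second moments are ever measured by the norm, and all norms of `ℝⁿ` give
the same notion of finite second moment. -/
abbrev Vec (n : ℕ) : Type := Fin n → ℝ

/-- Disjoint-union σ-algebra on `α ∪ {∅}`: a set is measurable iff its trace on `α` is. -/
instance instMeasurableSpaceOption {α : Type*} [m : MeasurableSpace α] :
    MeasurableSpace (Option α) :=
  m.map some

/-- The set `Δ(ℝⁿ)` of probability measures on `ℝⁿ` with finite second moment. -/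
def IsBelief {n : ℕ} (θ : Measure (Vec n)) : Prop :=
  IsProbabilityMeasure θ ∧ MemLp (fun x : Vec n => x) 2 θ

/-- `Δ(ℝⁿ)` as a type. -/
abbrev Belief (n : ℕ) : Type := {θ : Measure (Vec n) // IsBelief θ}

/-- The data of the switched linear system: horizon, dimensions, numbers of modes, system matrices,
cost matrices, and the distributions of the primitive random variables. -/
structure System where
  T : ℕ
  dX0 : ℕ
  dX1 : ℕ
  dU0 : ℕ
  dU1 : ℕ
  κ0 : ℕ
  κ1 : ℕ
  A00 : Fin κ0 → Matrix (Fin dX0) (Fin dX0) ℝ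
  A10 : Fin κ0 → Fin κ1 → Matrix (Fin dX1) (Fin dX0) ℝ
  A11 : Fin κ0 → Fin κ1 → Matrix (Fin dX1) (Fin dX1) ℝ
  B00 : Fin κ0 → Matrix (Fin dX0) (Fin dU0) ℝ
  B10 : Fin κ0 → Fin κ1 → Matrix (Fin dX1) (Fin dU0) ℝ
  B11 : Fin κ0 → Fin κ1 → Matrix (Fin dX1) (Fin dU1) ℝ
  Q : ℕ → Fin κ0 → Fin κ1 → Matrix (Fin dX0 ⊕ Fin dX1) (Fin dX0 ⊕ Fin dX1) ℝ
  R : ℕ → Fin κ0 → Fin κ1 → Matrix (Fin dU0 ⊕ Fin dU1) (Fin dU0 ⊕ Fin dU1) ℝ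
  posSemidef_Q : ∀ t ≤ T, ∀ m0 m1, (Q t m0 m1).PosSemidef
  posDef_R : ∀ t ≤ T, ∀ m0 m1, (R t m0 m1).PosDef
  /-- laws of the initial states -/
  πX0 : Measure (Vec dX0)
  πX1 : Measure (Vec dX1)
  isBelief_πX0 : IsBelief πX0
  isBelief_πX1 : IsBelief πX1
  /-- laws of the noises at each time -/
  πW0 : ℕ → Measure (Vec dX0)
  πW1 : ℕ → Measure (Vec dX1)
  isBelief_πW0 : ∀ t ≤ T, IsBelief (πW0 t)
  isBelief_πW1 : ∀ t ≤ T, IsBelief (πW1 t)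
  mean_πW0 : ∀ t ≤ T, ∫ w, w ∂(πW0 t) = 0
  mean_πW1 : ∀ t ≤ T, ∫ w, w ∂(πW1 t) = 0
  /-- laws of the modes -/
  πM0 : Measure (Fin κ0)
  πM1 : Measure (Fin κ1)
  isProb_πM0 : IsProbabilityMeasure πM0
  isProb_πM1 : IsProbabilityMeasure πM1
  /-- law of the link state; `true` means that the packet arrives -/
  p : Measure Bool
  isProb_p : IsProbabilityMeasure p

namespace System

variable (S : System)

/-- Global plant: `X⁰_{t+1}` as a function of the time-`t` quantities. -/
def next0 (x0 : Vec S.dX0) (m0 : Fin S.κ0) (u0 : Vec S.dU0) (w0 : Vec S.dX0) : Vec S.dX0 :=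
  S.A00 m0 *ᵥ x0 + S.B00 m0 *ᵥ u0 + w0

/-- Local plant: `X¹_{t+1}` as a function of the time-`t` quantities. -/
def next1 (x0 : Vec S.dX0) (x1 : Vec S.dX1) (m0 : Fin S.κ0) (m1 : Fin S.κ1)
    (u0 : Vec S.dU0) (u1 : Vec S.dU1) (w1 : Vec S.dX1) : Vec S.dX1 :=
  S.A10 m0 m1 *ᵥ x0 + S.A11 m0 m1 *ᵥ x1 + S.B10 m0 m1 *ᵥ u0 + S.B11 m0 m1 *ᵥ u1 + w1

/-- The instantaneous cost `c_t`. -/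
def cost (t : ℕ) (x0 : Vec S.dX0) (x1 : Vec S.dX1) (m0 : Fin S.κ0) (m1 : Fin S.κ1)
    (u0 : Vec S.dU0) (u1 : Vec S.dU1) : ℝ :=
  Sum.elim x0 x1 ⬝ᵥ (S.Q t m0 m1 *ᵥ Sum.elim x0 x1) +
    Sum.elim u0 u1 ⬝ᵥ (S.R t m0 m1 *ᵥ Sum.elim u0 u1)

/-- The channel: the input arrives if the link is up, and `∅` (that is, `none`) is received
otherwise. -/
def channel {α : Type*} (γ : Bool) (a : α) : Option α := if γ then some a else none

/-! ### Primitive random variables -/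

/-- Names of the primitive random variables. -/
inductive Src (T : ℕ) : Type
  | x0 : Src T
  | x1 : Src T
  | w0 : Fin (T + 1) → Src T
  | w1 : Fin (T + 1) → Src T
  | m0 : Fin (T + 1) → Src T
  | m1 : Fin (T + 1) → Src T
  | link : Fin (T + 1) → Src T

/-- The space in which each primitive random variable takes its values. -/
def SrcVal : Src S.T → Type
  | .x0 => Vec S.dX0
  | .x1 => Vec S.dX1
  | .w0 _ => Vec S.dX0
  | .w1 _ => Vec S.dX1
  | .m0 _ => Fin S.κ0
  | .m1 _ => Fin S.κ1
  | .link _ => Bool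

instance instMeasurableSpaceSrcVal : ∀ i : Src S.T, MeasurableSpace (S.SrcVal i)
  | .x0 => inferInstanceAs (MeasurableSpace (Vec S.dX0))
  | .x1 => inferInstanceAs (MeasurableSpace (Vec S.dX1))
  | .w0 _ => inferInstanceAs (MeasurableSpace (Vec S.dX0))
  | .w1 _ => inferInstanceAs (MeasurableSpace (Vec S.dX1))
  | .m0 _ => inferInstanceAs (MeasurableSpace (Fin S.κ0))
  | .m1 _ => inferInstanceAs (MeasurableSpace (Fin S.κ1))
  | .link _ => inferInstanceAs (MeasurableSpace Bool)

/-- The law of each primitive random variable. -/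
def srcLaw : ∀ i : Src S.T, Measure (S.SrcVal i)
  | .x0 => S.πX0
  | .x1 => S.πX1
  | .w0 t => S.πW0 t
  | .w1 t => S.πW1 t
  | .m0 _ => S.πM0
  | .m1 _ => S.πM1
  | .link _ => S.p

/-- The initial states, noises, modes and link states. Values at times after the horizon are
never used. -/
structure Sources (Ω : Type*) where
  X0 : Ω → Vec S.dX0
  X1 : Ω → Vec S.dX1
  W0 : ℕ → Ω → Vec S.dX0
  W1 : ℕ → Ω → Vec S.dX1
  M0 : ℕ → Ω → Fin S.κ0
  M1 : ℕ → Ω → Fin S.κ1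
  link : ℕ → Ω → Bool

variable {S}

/-- The primitive random variables up to the horizon, as one family. -/
def Sources.rv {Ω : Type*} (ξ : S.Sources Ω) : ∀ i : Src S.T, Ω → S.SrcVal i
  | .x0 => ξ.X0
  | .x1 => ξ.X1
  | .w0 t => ξ.W0 t
  | .w1 t => ξ.W1 t
  | .m0 t => ξ.M0 t
  | .m1 t => ξ.M1 t
  | .link t => ξ.link t

/-- The primitive random variables are measurable, have the prescribed distributions, and are
(jointly) independent. -/
structure Sources.Admissible {Ω : Type*} [MeasurableSpace Ω] (ξ : S.Sources Ω)
    (P : Measure Ω) : Prop where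
  measurable : ∀ i, Measurable (ξ.rv i)
  law : ∀ i, P.map (ξ.rv i) = S.srcLaw i
  indep : iIndepFun ξ.rv P

variable (S)

/-! ### Information and prescription strategies -/

/-- What becomes commonly known at each time: `(x⁰_t, m⁰_t, z_t, z̃_t)`. -/
abbrev Obs : Type := Vec S.dX0 × Fin S.κ0 × Option (Vec S.dX1) × Option (Fin S.κ1)

/-- The space of common information
`h⁰_t = (x⁰_{0:t}, m⁰_{0:t}, z_{0:t}, z̃_{0:t}, u⁰_{0:t-1})`, arranged chronologically. -/
def Hist : ℕ → Type
  | 0 => S.Obs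
  | t + 1 => Hist t × Vec S.dU0 × S.Obs

instance instMeasurableSpaceHist : ∀ t : ℕ, MeasurableSpace (S.Hist t)
  | 0 => inferInstanceAs (MeasurableSpace S.Obs)
  | t + 1 =>
    letI := instMeasurableSpaceHist t
    inferInstanceAs (MeasurableSpace (S.Hist t × Vec S.dU0 × S.Obs))

variable {S}

/-- The most recent observation `(x⁰_t, m⁰_t, z_t, z̃_t)` in `h⁰_t`. -/
def Hist.last : ∀ {t : ℕ}, S.Hist t → S.Obs
  | 0, h => h
  | _ + 1, h => h.2.2

/-- `x⁰_t` -/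
def Hist.x0 {t : ℕ} (h : S.Hist t) : Vec S.dX0 := h.last.1

/-- `m⁰_t` -/
def Hist.m0 {t : ℕ} (h : S.Hist t) : Fin S.κ0 := h.last.2.1

/-- `z̃_t` -/
def Hist.zTilde {t : ℕ} (h : S.Hist t) : Option (Fin S.κ1) := h.last.2.2.2

variable (S)

/-- Prescriptions for the local controller: maps from (local state, local mode) to actions.
The space `𝒫` consists of the measurable ones. -/
abbrev Presc : Type := Vec S.dX1 × Fin S.κ1 → Vec S.dU1

/-- A prescription strategy: `act t` is `φ⁰_t` and `presc t` is `φ¹_t`. -/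
structure Strategy where
  act : (t : ℕ) → S.Hist t → Vec S.dU0
  presc : (t : ℕ) → S.Hist t → S.Presc

variable {S}

section ClosedLoop

variable {Ω : Type*} (ξ : S.Sources Ω) (φ : S.Strategy)

/-- The pair `(H⁰_t, X¹_t)` when the strategy `φ` is used. -/
def loop : (t : ℕ) → Ω → S.Hist t × Vec S.dX1
  | 0, ω =>
    ((ξ.X0 ω, ξ.M0 0 ω, channel (ξ.link 0 ω) (ξ.X1 ω), channel (ξ.link 0 ω) (ξ.M1 0 ω)), ξ.X1 ω)
  | t + 1, ω =>
    let h := (loop t ω).1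
    let x1 := (loop t ω).2
    let u0 := φ.act t h
    let u1 := φ.presc t h (x1, ξ.M1 t ω)
    let x0' := S.next0 h.x0 (ξ.M0 t ω) u0 (ξ.W0 t ω)
    let x1' := S.next1 h.x0 x1 (ξ.M0 t ω) (ξ.M1 t ω) u0 u1 (ξ.W1 t ω)
    ((h, u0, x0', ξ.M0 (t + 1) ω, channel (ξ.link (t + 1) ω) x1',
      channel (ξ.link (t + 1) ω) (ξ.M1 (t + 1) ω)), x1')

/-- The common information `H⁰_t`. -/
def commonInfo (t : ℕ) (ω : Ω) : S.Hist t := (loop ξ φ t ω).1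

/-- The state `X⁰_t`. -/
def state0 (t : ℕ) (ω : Ω) : Vec S.dX0 := (commonInfo ξ φ t ω).x0

/-- The state `X¹_t`. -/
def state1 (t : ℕ) (ω : Ω) : Vec S.dX1 := (loop ξ φ t ω).2

/-- The action `U⁰_t`. -/
def action0 (t : ℕ) (ω : Ω) : Vec S.dU0 := φ.act t (commonInfo ξ φ t ω)

/-- The action `U¹_t`, given by applying the prescription to `(X¹_t, M¹_t)`. -/
def action1 (t : ℕ) (ω : Ω) : Vec S.dU1 :=
  φ.presc t (commonInfo ξ φ t ω) (state1 ξ φ t ω, ξ.M1 t ω)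

/-- The set `Φ^prs` of feasible prescription strategies: Borel measurable, with all states and
actions of finite second moment. -/
structure Feasible [MeasurableSpace Ω] (P : Measure Ω) : Prop where
  measurable_act : ∀ t ≤ S.T, Measurable (φ.act t)
  measurable_presc : ∀ t ≤ S.T,
    Measurable fun a : S.Hist t × (Vec S.dX1 × Fin S.κ1) => φ.presc t a.1 a.2
  memLp_state0 : ∀ t ≤ S.T, MemLp (state0 ξ φ t) 2 P
  memLp_state1 : ∀ t ≤ S.T, MemLp (state1 ξ φ t) 2 P
  memLp_action0 : ∀ t ≤ S.T, MemLp (action0 ξ φ t) 2 P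
  memLp_action1 : ∀ t ≤ S.T, MemLp (action1 ξ φ t) 2 P

/-- The expected total cost. The cost is nonnegative, so its expectation is taken in `[0, ∞]`. -/
def totalCost [MeasurableSpace Ω] (P : Measure Ω) : ℝ≥0∞ :=
  ∫⁻ ω, ∑ t ∈ Finset.range (S.T + 1), ENNReal.ofReal
    (S.cost t (state0 ξ φ t ω) (state1 ξ φ t ω) (ξ.M0 t ω) (ξ.M1 t ω)
      (action0 ξ φ t ω) (action1 ξ φ t ω)) ∂P

/-- `φ` is an optimal prescription strategy for the equivalent centralized problem. -/
def IsOptimal [MeasurableSpace Ω] (P : Measure Ω) : Prop :=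
  Feasible ξ φ P ∧ ∀ φ' : S.Strategy, Feasible ξ φ' P → totalCost ξ φ P ≤ totalCost ξ φ' P

/-- The common belief `θ_t`: the conditional distribution of `X¹_t` given `H⁰_t`, evaluated at the
realized common information. -/
def commonBelief [MeasurableSpace Ω] (P : Measure Ω) [IsFiniteMeasure P] (t : ℕ) (ω : Ω) :
    Measure (Vec S.dX1) :=
  condDistrib (state1 ξ φ t) (commonInfo ξ φ t) P (commonInfo ξ φ t ω)

end ClosedLoop

variable (S)

/-! ### The dynamic program -/

/-- `ω^{z̃}`, the common belief on the local mode. -/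
def modeBelief : Option (Fin S.κ1) → Measure (Fin S.κ1)
  | none => S.πM1
  | some l => Measure.dirac l

/-- The belief update `ψ_t(θ, (u⁰, ρ), x⁰, m⁰, z̃, z')`. -/
def beliefUpdate (t : ℕ) (θ : Measure (Vec S.dX1)) (u0 : Vec S.dU0) (ρ : S.Presc)
    (x0 : Vec S.dX0) (m0 : Fin S.κ0) (zt : Option (Fin S.κ1)) :
    Option (Vec S.dX1) → Measure (Vec S.dX1)
  | some x1' => Measure.dirac x1'
  | none =>
    (θ.prod ((S.modeBelief zt).prod (S.πW1 t))).map
      fun a => S.next1 x0 a.1 m0 a.2.1 u0 (ρ (a.1, a.2.1)) a.2.2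

/-- Candidate value functions `V_t : ℝ^{d_X^0} × 𝓜⁰ × Δ(ℝ^{d_X^1}) × (𝓜¹ ∪ {∅}) → ℝ`. -/
abbrev ValueFn : Type :=
  Vec S.dX0 → Fin S.κ0 → Belief S.dX1 → Option (Fin S.κ1) → ℝ

open Classical in
/-- A value function read with values in `[0, ∞]`, and as `∞` at distributions outside `Δ`. (The
value functions below are nonnegative, and an updated belief lies outside `Δ` only if the expected
instantaneous cost is already infinite, because `R_t` is positive definite.) -/
def ValueFn.ext {S : System} (V : S.ValueFn) (x0 : Vec S.dX0) (m0 : Fin S.κ0)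
    (θ : Measure (Vec S.dX1)) (zt : Option (Fin S.κ1)) : ℝ≥0∞ :=
  if hθ : IsBelief θ then ENNReal.ofReal (V x0 m0 ⟨θ, hθ⟩ zt) else ∞

/-- The expression that is minimized at time `t` of the dynamic program, for the prescription
`(u⁰, ρ)` and with `V` in the role of `V_{t+1}`. The components of the integration variable `a`
are the independent random variables
`X¹_t ∼ θ`, `M¹_t ∼ ω^{z̃}`, `W⁰_t`, `W¹_t`, `M⁰_{t+1}`, `M¹_{t+1}`, `Γ_{t+1}`. -/
def stageValue (t : ℕ) (V : S.ValueFn) (x0 : Vec S.dX0) (m0 : Fin S.κ0)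
    (θ : Measure (Vec S.dX1)) (zt : Option (Fin S.κ1)) (u0 : Vec S.dU0) (ρ : S.Presc) : ℝ≥0∞ :=
  ∫⁻ a : Vec S.dX1 × Fin S.κ1 × Vec S.dX0 × Vec S.dX1 × Fin S.κ0 × Fin S.κ1 × Bool,
    (let x1 := a.1
     let m1 := a.2.1
     let w0 := a.2.2.1
     let w1 := a.2.2.2.1
     let m0' := a.2.2.2.2.1
     let m1' := a.2.2.2.2.2.1
     let γ' := a.2.2.2.2.2.2
     let u1 := ρ (x1, m1)
     let x0' := S.next0 x0 m0 u0 w0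
     let x1' := S.next1 x0 x1 m0 m1 u0 u1 w1
     ENNReal.ofReal (S.cost t x0 x1 m0 m1 u0 u1) +
       V.ext x0' m0' (S.beliefUpdate t θ u0 ρ x0 m0 zt (channel γ' x1')) (channel γ' m1'))
    ∂(θ.prod ((S.modeBelief zt).prod ((S.πW0 t).prod ((S.πW1 t).prod
      (S.πM0.prod (S.πM1.prod S.p))))))

/-- The set `𝒬̄` of (measurable) functions of the local mode. -/
def QBar : Set (Fin S.κ1 → Vec S.dU1) := {q | Measurable q}

/-- The set `𝒬̃(θ)` of measurable prescriptions with zero mean under `θ` for every local mode. -/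
def QTilde (θ : Measure (Vec S.dX1)) : Set S.Presc :=
  {q | Measurable q ∧
    ∀ m1, Integrable (fun x1 => q (x1, m1)) θ ∧ ∫ x1, q (x1, m1) ∂θ = 0}

/-- The prescription `q̄ ∘ h₂ + q̃`, where `h₂(x¹, m¹) = m¹`. -/
def combine (qb : Fin S.κ1 → Vec S.dU1) (qt : S.Presc) : S.Presc := qb ∘ Prod.snd + qt

/-- `V_0, …, V_{T+1}` solve the dynamic program whose minimization runs over
`u⁰`, `q̄ ∈ 𝒬̄` and `q̃ ∈ 𝒬̃(θ)`. -/
structure SolvesDP (V : ℕ → S.ValueFn) : Prop where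
  terminal : ∀ x0 m0 θ zt, V (S.T + 1) x0 m0 θ zt = 0
  step : ∀ t ≤ S.T, ∀ x0 m0 (θ : Belief S.dX1) zt,
    IsLeast
      {y : EReal | ∃ u0, ∃ qb ∈ S.QBar, ∃ qt ∈ S.QTilde θ.1,
        y = (S.stageValue t (V (t + 1)) x0 m0 θ.1 zt u0 (S.combine qb qt) : EReal)}
      ((V t x0 m0 θ zt : ℝ) : EReal)

variable {S}

/-- At (almost) every realization of the common information, with the corresponding common belief
`θ_t`, the prescription selected by `φ` is of the form `(u⁰, q̄ ∘ h₂ + q̃)` with `q̄ ∈ 𝒬̄`,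
`q̃ ∈ 𝒬̃(θ_t)`, and achieves the minimum in the definition of `V_t`. -/
def AchievesMin {Ω : Type*} [MeasurableSpace Ω] (ξ : S.Sources Ω) (φ : S.Strategy)
    (P : Measure Ω) [IsFiniteMeasure P] (V : ℕ → S.ValueFn) : Prop :=
  ∀ t ≤ S.T, ∀ᵐ ω ∂P, ∀ hθ : IsBelief (commonBelief ξ φ P t ω),
    let h := commonInfo ξ φ t ω
    let θ : Belief S.dX1 := ⟨commonBelief ξ φ P t ω, hθ⟩
    ∃ qb ∈ S.QBar, ∃ qt ∈ S.QTilde θ.1,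
      φ.presc t h = S.combine qb qt ∧
      (S.stageValue t (V (t + 1)) h.x0 h.m0 θ.1 h.zTilde (φ.act t h) (S.combine qb qt) : EReal) =
        ((V t h.x0 h.m0 θ h.zTilde : ℝ) : EReal)

end System

end SwitchedNCS

end

open SwitchedNCS

/-!
Given the common information `h⁰_t`, the state `X¹_t` and the mode `M¹_t` are independent, with laws
`θ_t` and `ω^{z̃_t}`, and `θ_{t+1}` is obtained from `θ_t` by `ψ_t`: the variables which have not
entered the system by time `t` are independent of those which have. So the expectation in the
dynamic program is the conditional expectation of `c_t` plus the value at time `t + 1`.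

The tower property needs `V_{t+1}` to be measurable along the beliefs, which is not assumed.
Backward induction shows that `V_t (x⁰, m⁰, θ, z̃)` is a quadratic form in `(x⁰, ∫ x dθ)` plus a
linear function of the covariance of `θ` plus a constant, with coefficients depending on `(m⁰, z̃)`.
The reason is that the stage cost splits into a part depending on `(u⁰, q̄)` through the mean of `θ`
and a part depending on `q̃` through the deviation from the mean, and each part is minimized by
completing the square.

Telescoping then bounds the cost of every feasible strategy below by the mean of `V_0`, with
equality when the minima are attained along the trajectory.
-/

noncomputable section

namespace SwitchedNCS

section QuadraticForm

variable {E : Type*} [NormedAddCommGroup E] [NormedSpace ℝ E] [FiniteDimensional ℝ E]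

theorem norm_quadraticForm_le (Q : QuadraticForm ℝ E) : ∃ C, ∀ x, ‖Q x‖ ≤ C * ‖x‖ ^ 2 := by
  refine ⟨‖(QuadraticMap.associated Q).toContinuousBilinearMap‖, fun x => ?_⟩
  calc ‖Q x‖ = ‖(QuadraticMap.associated Q).toContinuousBilinearMap x x‖ := by
        rw [LinearMap.toContinuousBilinearMap_apply, QuadraticMap.associated_eq_self_apply]
    _ ≤ _ * ‖x‖ * ‖x‖ := ContinuousLinearMap.le_opNorm₂ _ _ _
    _ = _ * ‖x‖ ^ 2 := by ring

theorem continuous_quadraticForm (Q : QuadraticForm ℝ E) : Continuous Q := by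
  have h (x : E) : Q x = (QuadraticMap.associated Q).toContinuousBilinearMap x x := by
    rw [LinearMap.toContinuousBilinearMap_apply, QuadraticMap.associated_eq_self_apply]
  simp only [funext h]
  fun_prop

section Measurable

variable [MeasurableSpace E] [BorelSpace E] {ι A : Type*} [Countable ι] [MeasurableSpace ι]
  [MeasurableSingletonClass ι] [MeasurableSpace A] {f : A → ι} {v : A → E}

theorem measurable_quadraticForm_apply (Q : ι → QuadraticForm ℝ E) (hf : Measurable f)
    (hv : Measurable v) : Measurable fun a => Q (f a) (v a) := by
  have h : Measurable fun b : ι × E => Q b.1 b.2 :=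
    measurable_from_prod_countable_right fun i => (continuous_quadraticForm (Q i)).measurable
  exact h.comp (hf.prodMk hv)

theorem measurable_linearMap_apply {F : Type*} [NormedAddCommGroup F] [NormedSpace ℝ F]
    [MeasurableSpace F] [BorelSpace F] (L : ι → E →ₗ[ℝ] F) (hf : Measurable f)
    (hv : Measurable v) : Measurable fun a => L (f a) (v a) := by
  have h : Measurable fun b : ι × E => L b.1 b.2 :=
    measurable_from_prod_countable_right fun i =>
      (L i).continuous_of_finiteDimensional.measurable
  exact h.comp (hf.prodMk hv)

end Measurable

section Integral

variable {α : Type*} [MeasurableSpace α] {μ : Measure α} {Y : α → E}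

theorem integrable_quadraticForm_comp (Q : QuadraticForm ℝ E) (hY : MemLp Y 2 μ) :
    Integrable (fun a => Q (Y a)) μ := by
  obtain ⟨C, hC⟩ := norm_quadraticForm_le Q
  exact ((hY.integrable_norm_pow two_ne_zero).const_mul C).mono'
    ((continuous_quadraticForm Q).comp_aestronglyMeasurable hY.1) (ae_of_all _ fun a => hC (Y a))

theorem integral_quadraticForm_const_add [IsProbabilityMeasure μ] (Q : QuadraticForm ℝ E)
    (hY : MemLp Y 2 μ) (hY0 : ∫ a, Y a ∂μ = 0) (c : E) :
    ∫ a, Q (c + Y a) ∂μ = Q c + ∫ a, Q (Y a) ∂μ := by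
  have hYi : Integrable Y μ := hY.integrable one_le_two
  let B : E →L[ℝ] ℝ := (Q.polarBilin c).toContinuousLinearMap
  have hB : ∫ a, B (Y a) ∂μ = 0 := by rw [B.integral_comp_comm hYi, hY0, map_zero]
  calc ∫ a, Q (c + Y a) ∂μ = ∫ a, (Q c + (Q (Y a) + B (Y a))) ∂μ := by
        simp only [QuadraticMap.map_add Q c, add_assoc]; rfl
    _ = ∫ _, Q c ∂μ + (∫ a, Q (Y a) ∂μ + ∫ a, B (Y a) ∂μ) := by
        have hQY := integrable_quadraticForm_comp Q hY
        have hBY := B.integrable_comp hYi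
        rw [← integral_add hQY hBY]
        exact integral_add (integrable_const _) (hQY.add hBY)
    _ = Q c + ∫ a, Q (Y a) ∂μ := by simp [hB]

theorem lintegral_quadraticForm_const_add [IsProbabilityMeasure μ] {Q : QuadraticForm ℝ E}
    (hQ : ∀ x, 0 ≤ Q x) (hY : MemLp Y 2 μ) (hY0 : ∫ a, Y a ∂μ = 0) (c : E) :
    ∫⁻ a, ENNReal.ofReal (Q (c + Y a)) ∂μ =
      ENNReal.ofReal (Q c) + ∫⁻ a, ENNReal.ofReal (Q (Y a)) ∂μ := by
  have hcY : MemLp (fun a => c + Y a) 2 μ := (memLp_const c).add hY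
  rw [← ofReal_integral_eq_lintegral_ofReal (integrable_quadraticForm_comp Q hcY)
      (ae_of_all _ fun a => hQ _),
    ← ofReal_integral_eq_lintegral_ofReal (integrable_quadraticForm_comp Q hY)
      (ae_of_all _ fun a => hQ _),
    integral_quadraticForm_const_add Q hY hY0,
    ENNReal.ofReal_add (hQ c) (integral_nonneg fun a => hQ _)]

end Integral

end QuadraticForm

section Minimizer

variable {X U : Type*} [AddCommGroup X] [Module ℝ X] [AddCommGroup U] [Module ℝ U]

theorem polar_eq_zero_of_apply_eq_zero {Q : QuadraticForm ℝ X} (hQ : ∀ x, 0 ≤ Q x) {y : X}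
    (hy : Q y = 0) (x : X) : QuadraticMap.polar Q x y = 0 := by
  have h := LinearMap.BilinForm.apply_sq_le_of_symm Q.polarBilin
    (fun x => by simpa [QuadraticMap.polar_self] using hQ x) ⟨QuadraticMap.polar_comm Q⟩ x y
  simp only [QuadraticMap.polarBilin_apply_apply, QuadraticMap.polar_self, hy, smul_zero,
    mul_zero] at h
  exact sq_nonpos_iff _ |>.1 h

theorem mem_range_of_forall_ker [FiniteDimensional ℝ U] {B : LinearMap.BilinForm ℝ U}
    (hB : B.IsSymm) {f : Module.Dual ℝ U} (hf : ∀ v, B v = 0 → f v = 0) :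
    f ∈ LinearMap.range B := by
  have hf' : f ∈ LinearMap.range (LinearMap.dualMap B) := by
    rw [LinearMap.range_dualMap_eq_dualAnnihilator_ker, Submodule.mem_dualAnnihilator]
    exact fun v hv => hf v hv
  obtain ⟨g, rfl⟩ := hf'
  obtain ⟨u, rfl⟩ := (Module.evalEquiv ℝ U).surjective g
  exact ⟨u, LinearMap.ext fun v => hB.eq u v⟩

theorem exists_comp_eq_of_range_le {W : Type*} [AddCommGroup W] [Module ℝ W] {f : X →ₗ[ℝ] W}
    {g : U →ₗ[ℝ] W} (h : LinearMap.range f ≤ LinearMap.range g) :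
    ∃ L : X →ₗ[ℝ] U, g ∘ₗ L = f := by
  obtain ⟨L, hL⟩ := Module.projective_lifting_property g.rangeRestrict
    (f.codRestrict _ fun x => h ⟨x, rfl⟩) g.surjective_rangeRestrict
  exact ⟨L, LinearMap.ext fun x => congrArg Subtype.val (LinearMap.congr_fun hL x)⟩

theorem exists_linearMap_minimizer [FiniteDimensional ℝ U] {Q : QuadraticForm ℝ (X × U)}
    (hQ : ∀ z, 0 ≤ Q z) : ∃ L : X →ₗ[ℝ] U, ∀ x u, Q (x, L x) ≤ Q (x, u) := by
  let B : LinearMap.BilinForm ℝ U := (Q.comp (LinearMap.inr ℝ X U)).polarBilin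
  let f : X →ₗ[ℝ] Module.Dual ℝ U :=
    Q.polarBilin.compl₁₂ (-LinearMap.inl ℝ X U) (LinearMap.inr ℝ X U)
  have hf : LinearMap.range f ≤ LinearMap.range B := by
    rintro _ ⟨x, rfl⟩
    refine mem_range_of_forall_ker ⟨QuadraticMap.polar_comm _⟩ fun v hv => ?_
    have hv : Q (0, v) = 0 := by
      simpa [B, QuadraticMap.polar_self] using LinearMap.congr_fun hv v
    exact polar_eq_zero_of_apply_eq_zero hQ hv _
  obtain ⟨L, hL⟩ := exists_comp_eq_of_range_le hf
  have orthogonal (x : X) (v : U) : QuadraticMap.polar Q (x, L x) (0, v) = 0 := by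
    have h : QuadraticMap.polar Q (0, L x) (0, v) = QuadraticMap.polar Q (-(x, 0)) (0, v) := by
      simpa [B, f, QuadraticMap.polar] using LinearMap.congr_fun (LinearMap.congr_fun hL x) v
    rw [show (x, L x) = (x, 0) + (0, L x) by simp, QuadraticMap.polar_add_left, h,
      QuadraticMap.polar_neg_left, add_neg_cancel]
  refine ⟨L, fun x u => ?_⟩
  calc Q (x, L x) ≤ Q (x, L x) + Q (0, u - L x) := le_add_of_nonneg_right (hQ _)
    _ = Q (x, u) := by
      rw [← add_zero (_ + _), ← orthogonal x (u - L x), ← QuadraticMap.map_add]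
      simp

end Minimizer

section PosDef

variable {E : Type*} [NormedAddCommGroup E] [NormedSpace ℝ E] [FiniteDimensional ℝ E]

theorem exists_norm_sq_le_mul_of_posDef {Q : QuadraticForm ℝ E} (hQ : Q.PosDef) :
    ∃ C, ∀ x, ‖x‖ ^ 2 ≤ C * Q x := by
  have hcont : ContinuousOn (fun x => (Q x)⁻¹) (Metric.sphere 0 1) :=
    (continuous_quadraticForm Q).continuousOn.inv₀ fun x hx =>
      (hQ x (ne_zero_of_mem_unit_sphere ⟨x, hx⟩)).ne'
  obtain ⟨C, hC⟩ := (isCompact_sphere (0 : E) 1).bddAbove_image hcont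
  refine ⟨C, fun x => ?_⟩
  obtain rfl | hx := eq_or_ne x 0
  · simp
  have hunit : ‖x‖⁻¹ • x ∈ Metric.sphere (0 : E) 1 := by simp [norm_smul, hx]
  have hle : (Q (‖x‖⁻¹ • x))⁻¹ ≤ C := hC ⟨_, hunit, rfl⟩
  have hpos : 0 < Q x := hQ x hx
  calc ‖x‖ ^ 2 = (Q (‖x‖⁻¹ • x))⁻¹ * Q x := by
        rw [QuadraticMap.map_smul, smul_eq_mul]
        field_simp
    _ ≤ C * Q x := by gcongr

end PosDef

section Average

variable {ι E : Type*} [Fintype ι] [MeasurableSpace ι] [AddCommGroup E] [Module ℝ E]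

/-- The quadratic form `x ↦ ∫ Q i x μ(di)`, for a family of quadratic forms with finite index
set. -/
def averageForm (μ : Measure ι) (Q : ι → QuadraticForm ℝ E) : QuadraticForm ℝ E :=
  ∑ i, μ.real {i} • Q i

theorem averageForm_apply (μ : Measure ι) (Q : ι → QuadraticForm ℝ E) (x : E) :
    averageForm μ Q x = ∑ i, μ.real {i} * Q i x := by
  simp [averageForm]

variable {μ : Measure ι} {Q : ι → QuadraticForm ℝ E}

theorem averageForm_nonneg (hQ : ∀ i x, 0 ≤ Q i x) (x : E) : 0 ≤ averageForm μ Q x := by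
  rw [averageForm_apply]
  exact Finset.sum_nonneg fun i _ => mul_nonneg measureReal_nonneg (hQ i x)

theorem ofReal_averageForm [MeasurableSingletonClass ι] [IsFiniteMeasure μ]
    (hQ : ∀ i x, 0 ≤ Q i x) (x : E) :
    ENNReal.ofReal (averageForm μ Q x) = ∫⁻ i, ENNReal.ofReal (Q i x) ∂μ := by
  rw [averageForm_apply, lintegral_fintype,
    ENNReal.ofReal_sum_of_nonneg fun i _ => mul_nonneg measureReal_nonneg (hQ i x)]
  refine Finset.sum_congr rfl fun i _ => ?_
  rw [ENNReal.ofReal_mul measureReal_nonneg, ofReal_measureReal, mul_comm]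

end Average

section Option

variable {α β γ : Type*} [MeasurableSpace α] [MeasurableSpace β] [MeasurableSpace γ]

theorem measurable_some : Measurable (some : α → Option α) := fun _ hs => hs

theorem measurable_of_some {f : Option α → β} (hf : Measurable fun a => f (some a)) :
    Measurable f := fun _ hs => hf hs

instance [DiscreteMeasurableSpace α] : DiscreteMeasurableSpace (Option α) :=
  ⟨fun _ => MeasurableSet.of_discrete (α := α)⟩

theorem measurable_isSome : Measurable (Option.isSome : Option α → Bool) :=
  measurable_of_some measurable_const

theorem measurable_getD (a : α) : Measurable fun z : Option α => z.getD a :=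
  measurable_of_some measurable_id

theorem measurable_channel {c : β → Bool} {f : β → α} (hc : Measurable c) (hf : Measurable f) :
    Measurable fun b => System.channel (c b) (f b) := by
  have h : Measurable fun a : Bool × α => System.channel a.1 a.2 :=
    measurable_from_prod_countable_right fun c => by
      cases c
      · exact measurable_const
      · exact measurable_some
  exact h.comp (hc.prodMk hf)

theorem measurable_prod_option {f : β × Option α → γ} (hnone : Measurable fun b => f (b, none))
    (hsome : Measurable fun a : β × α => f (a.1, some a.2)) : Measurable f := by
  cases isEmpty_or_nonempty α
  · convert hnone.comp (measurable_fst (β := Option α)) using 1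
    exact funext fun ⟨b, z⟩ => by rw [Subsingleton.elim z none]; rfl
  obtain ⟨a₀⟩ := ‹Nonempty α›
  have hbranch : f = fun a => if a.2.isSome then f (a.1, some (a.2.getD a₀)) else f (a.1, none) :=
    funext fun ⟨b, z⟩ => by cases z <;> rfl
  rw [hbranch]
  refine Measurable.ite ?_ (hsome.comp (measurable_fst.prodMk ?_)) (hnone.comp measurable_fst)
  · exact measurable_isSome.comp measurable_snd (MeasurableSet.singleton true)
  · exact (measurable_getD a₀).comp measurable_snd

end Option

section Kernel

variable {A B Y : Type*} [MeasurableSpace A] [MeasurableSpace B] [MeasurableSpace Y]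

theorem measurable_map_kernel (κ : Kernel A B) [IsSFiniteKernel κ] {f : A × B → Y}
    (hf : Measurable f) : Measurable fun a => (κ a).map fun b => f (a, b) := by
  refine Measure.measurable_of_measurable_coe _ fun s hs => ?_
  have hmap (a : A) : (κ a).map (fun b => f (a, b)) s = κ a (Prod.mk a ⁻¹' (f ⁻¹' s)) :=
    Measure.map_apply (hf.comp measurable_prodMk_left) hs
  simp only [hmap]
  exact Kernel.measurable_kernel_prodMk_left (hf hs)

variable {Ω : Type*} [MeasurableSpace Ω] {P : Measure Ω} [IsProbabilityMeasure P]
  {C : Ω → A} {X : Ω → Y} {κ : Kernel A Y} [IsMarkovKernel κ]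

theorem lintegral_comp_of_hasCondDistrib (h : HasCondDistrib X C κ P) {f : A × Y → ℝ≥0∞}
    (hf : Measurable f) :
    ∫⁻ ω, f (C ω, X ω) ∂P = ∫⁻ ω, ∫⁻ y, f (C ω, y) ∂κ (C ω) ∂P := by
  rw [h.lintegral_comp hf.aemeasurable, Measure.lintegral_compProd hf,
    lintegral_map' hf.lintegral_kernel_prod_right'.aemeasurable h.aemeasurable_fst]

theorem hasCondDistrib_of_lintegral (hX : Measurable X) (hC : Measurable C)
    (h : ∀ f : A × Y → ℝ≥0∞, Measurable f →
      ∫⁻ ω, f (C ω, X ω) ∂P = ∫⁻ ω, ∫⁻ y, f (C ω, y) ∂κ (C ω) ∂P) :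
    HasCondDistrib X C κ P := by
  refine ⟨(hC.prodMk hX).aemeasurable, Measure.ext_of_lintegral _ fun f hf => ?_⟩
  rw [lintegral_map hf (hC.prodMk hX), Measure.lintegral_compProd hf,
    lintegral_map hf.lintegral_kernel_prod_right' hC, h f hf]

theorem hasCondDistrib_of_erasure {Γ : Ω → Bool} {p : Measure Bool} [IsProbabilityMeasure p]
    (hX : Measurable X) (hC : Measurable C) (hΓ : Measurable Γ)
    (h : HasCondDistrib (fun ω => (X ω, Γ ω)) C (κ ×ₖ Kernel.const A p) P)
    {g : A × Y × Bool → B} (hg : Measurable g) {η : Kernel B Y} [IsMarkovKernel η]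
    (hg_false : ∀ a y y', g (a, y, false) = g (a, y', false))
    (hη_true : ∀ a y, η (g (a, y, true)) = Measure.dirac y)
    (hη_false : ∀ a y, η (g (a, y, false)) = κ a) :
    HasCondDistrib X (fun ω => g (C ω, X ω, Γ ω)) η P := by
  refine hasCondDistrib_of_lintegral hX (hg.comp (hC.prodMk (hX.prodMk hΓ))) fun f hf => ?_
  have hl : Measurable fun a : A × Y × Bool => f (g a, a.2.1) := by fun_prop
  have hr : Measurable fun a : A × Y × Bool => ∫⁻ y, f (g a, y) ∂η (g a) :=
    hf.lintegral_kernel_prod_right'.comp hg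
  rw [lintegral_comp_of_hasCondDistrib h hl, lintegral_comp_of_hasCondDistrib h hr]
  refine lintegral_congr fun ω => ?_
  have hl' : Measurable fun b => f (g (C ω, b), b.1) := hl.comp measurable_prodMk_left
  have hr' : Measurable fun b => ∫⁻ y, f (g (C ω, b), y) ∂η (g (C ω, b)) :=
    hr.comp measurable_prodMk_left
  rw [Kernel.prod_apply, Kernel.const_apply, lintegral_prod_symm _ hl'.aemeasurable,
    lintegral_prod_symm _ hr'.aemeasurable]
  refine lintegral_congr fun c => ?_
  cases c
  · obtain ⟨y₀⟩ : Nonempty Y := (κ (C ω)).nonempty_of_neZero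
    simp only [hη_false, hg_false _ _ y₀, lintegral_const, measure_univ, mul_one]
  · simp only [hη_true]
    exact lintegral_congr fun y =>
      (lintegral_dirac' y (hf.comp measurable_prodMk_left)).symm

end Kernel

namespace System

section Laws

variable (S : System)

instance : IsProbabilityMeasure S.πX0 := S.isBelief_πX0.1

instance : IsProbabilityMeasure S.πX1 := S.isBelief_πX1.1

instance : IsProbabilityMeasure S.πM0 := S.isProb_πM0

instance : IsProbabilityMeasure S.πM1 := S.isProb_πM1

instance : IsProbabilityMeasure S.p := S.isProb_p

instance (zt : Option (Fin S.κ1)) : IsProbabilityMeasure (S.modeBelief zt) := by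
  cases zt
  · exact S.isProb_πM1
  · exact Measure.dirac.isProbabilityMeasure

theorem isBelief_dirac {n : ℕ} (x : Vec n) : IsBelief (Measure.dirac x) :=
  ⟨inferInstance, (memLp_const x).ae_eq (ae_eq_dirac' measurable_id).symm⟩

end Laws

section Forms

/-- The quadratic form `(x, y) ↦ [x; y]ᵀ A [x; y]` of a block matrix `A`. -/
def blockForm {m n : ℕ} (A : Matrix (Fin m ⊕ Fin n) (Fin m ⊕ Fin n) ℝ) :
    QuadraticForm ℝ (Vec m × Vec n) :=
  A.toQuadraticForm'.comp (LinearEquiv.sumArrowLequivProdArrow _ _ ℝ ℝ).symm.toLinearMap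

theorem blockForm_apply {m n : ℕ} (A : Matrix (Fin m ⊕ Fin n) (Fin m ⊕ Fin n) ℝ)
    (x : Vec m × Vec n) : blockForm A x = Sum.elim x.1 x.2 ⬝ᵥ (A *ᵥ Sum.elim x.1 x.2) :=
  Matrix.toLinearMap₂'_apply' A _ _

theorem blockForm_posDef {m n : ℕ} {A : Matrix (Fin m ⊕ Fin n) (Fin m ⊕ Fin n) ℝ}
    (hA : A.PosDef) : (blockForm A).PosDef := fun _ hx =>
  hA.toQuadraticForm' _ ((map_ne_zero_iff _ (LinearEquiv.injective _)).2 hx)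

variable (S : System)

/-- The states and actions at one time, in the order `((x⁰, x¹), (u⁰, u¹))`. -/
abbrev StageVec : Type := (Vec S.dX0 × Vec S.dX1) × (Vec S.dU0 × Vec S.dU1)

/-- The instantaneous cost `c_t` for given modes, as a quadratic form. -/
def costForm (t : ℕ) (m0 : Fin S.κ0) (m1 : Fin S.κ1) : QuadraticForm ℝ S.StageVec :=
  (blockForm (S.Q t m0 m1)).prod (blockForm (S.R t m0 m1))

/-- The noiseless part of the dynamics of `X⁰`. -/
def drift0 (m0 : Fin S.κ0) : S.StageVec →ₗ[ℝ] Vec S.dX0 :=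
  ((S.A00 m0).mulVecLin ∘ₗ LinearMap.fst ℝ _ _).coprod
    ((S.B00 m0).mulVecLin ∘ₗ LinearMap.fst ℝ _ _)

/-- The noiseless part of the dynamics of `X¹`. -/
def drift1 (m0 : Fin S.κ0) (m1 : Fin S.κ1) : S.StageVec →ₗ[ℝ] Vec S.dX1 :=
  ((S.A10 m0 m1).mulVecLin.coprod (S.A11 m0 m1).mulVecLin).coprod
    ((S.B10 m0 m1).mulVecLin.coprod (S.B11 m0 m1).mulVecLin)

variable {S}

theorem next0_eq (m0 : Fin S.κ0) (v : S.StageVec) (w0 : Vec S.dX0) :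
    S.next0 v.1.1 m0 v.2.1 w0 = S.drift0 m0 v + w0 := rfl

theorem next1_eq (m0 : Fin S.κ0) (m1 : Fin S.κ1) (v : S.StageVec) (w1 : Vec S.dX1) :
    S.next1 v.1.1 v.1.2 m0 m1 v.2.1 v.2.2 w1 = S.drift1 m0 m1 v + w1 := by
  simp [next1, drift1, add_assoc]

theorem cost_eq (t : ℕ) (m0 : Fin S.κ0) (m1 : Fin S.κ1) (v : S.StageVec) :
    S.cost t v.1.1 v.1.2 m0 m1 v.2.1 v.2.2 = S.costForm t m0 m1 v := by
  simp [cost, costForm, blockForm_apply]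

variable {t : ℕ}

theorem blockForm_R_le_costForm (ht : t ≤ S.T) (m0 : Fin S.κ0) (m1 : Fin S.κ1)
    (v : S.StageVec) : blockForm (S.R t m0 m1) v.2 ≤ S.costForm t m0 m1 v := by
  have hQ : 0 ≤ blockForm (S.Q t m0 m1) v.1 := by
    rw [blockForm_apply]
    simpa using (S.posSemidef_Q t ht m0 m1).dotProduct_mulVec_nonneg (Sum.elim v.1.1 v.1.2)
  exact le_add_of_nonneg_left hQ

theorem costForm_nonneg (ht : t ≤ S.T) (m0 : Fin S.κ0) (m1 : Fin S.κ1) (v : S.StageVec) :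
    0 ≤ S.costForm t m0 m1 v :=
  ((blockForm_posDef (S.posDef_R t ht m0 m1)).nonneg v.2).trans
    (blockForm_R_le_costForm ht m0 m1 v)

theorem exists_norm_action_sq_le_mul_costForm (ht : t ≤ S.T) (m0 : Fin S.κ0) :
    ∃ C, ∀ m1 (v : S.StageVec), ‖v.2.2‖ ^ 2 ≤ C * S.costForm t m0 m1 v := by
  have hR (m1 : Fin S.κ1) := blockForm_posDef (S.posDef_R t ht m0 m1)
  choose C hC using fun m1 => exists_norm_sq_le_mul_of_posDef (hR m1)
  refine ⟨∑ m1, |C m1|, fun m1 v => ?_⟩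
  have hCm : C m1 ≤ ∑ m1, |C m1| := (le_abs_self _).trans
    (Finset.single_le_sum (f := fun m1 => |C m1|) (fun _ _ => abs_nonneg _) (Finset.mem_univ m1))
  calc ‖v.2.2‖ ^ 2 ≤ ‖v.2‖ ^ 2 := by gcongr; exact norm_snd_le v.2
    _ ≤ C m1 * blockForm (S.R t m0 m1) v.2 := hC m1 v.2
    _ ≤ (∑ m1, |C m1|) * blockForm (S.R t m0 m1) v.2 :=
      mul_le_mul_of_nonneg_right hCm ((hR m1).nonneg v.2)
    _ ≤ (∑ m1, |C m1|) * S.costForm t m0 m1 v :=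
      mul_le_mul_of_nonneg_left (blockForm_R_le_costForm ht m0 m1 v)
        (Finset.sum_nonneg fun _ _ => abs_nonneg _)

end Forms

end System

namespace System

variable {S : System}

theorem isBelief_iff_lintegral_lt_top {n : ℕ} (θ : Measure (Vec n)) [IsProbabilityMeasure θ] :
    IsBelief θ ↔ ∫⁻ x, ‖x‖ₑ ^ 2 ∂θ < ∞ := by
  have h := eLpNorm_lt_top_iff_lintegral_rpow_enorm_lt_top (f := fun x : Vec n => x) (μ := θ)
    two_ne_zero ENNReal.ofNat_ne_top
  simp only [ENNReal.toReal_ofNat, ENNReal.rpow_ofNat] at h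
  rw [← h]
  exact ⟨fun hθ => hθ.2.2, fun hθ => ⟨inferInstance, measurable_id.aestronglyMeasurable, hθ⟩⟩

theorem ValueFn.ext_of_isBelief (V : S.ValueFn) (x0 : Vec S.dX0) (m0 : Fin S.κ0)
    {θ : Measure (Vec S.dX1)} (hθ : IsBelief θ) (zt : Option (Fin S.κ1)) :
    V.ext x0 m0 θ zt = ENNReal.ofReal (V x0 m0 ⟨θ, hθ⟩ zt) := dif_pos hθ

theorem ValueFn.ext_of_not_isBelief (V : S.ValueFn) (x0 : Vec S.dX0) (m0 : Fin S.κ0)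
    {θ : Measure (Vec S.dX1)} (hθ : ¬IsBelief θ) (zt : Option (Fin S.κ1)) :
    V.ext x0 m0 θ zt = ∞ := dif_neg hθ

variable (S) in
/-- The coefficients of a function of `(x⁰, m⁰, θ, z̃)` that is quadratic in `x⁰` and the mean of
`θ`, and linear in the covariance of `θ`; `cov` enters through its expectation at the deviation
from the mean. -/
structure QuadraticValue where
  mean : Fin S.κ0 → Option (Fin S.κ1) → QuadraticForm ℝ (Vec S.dX0 × Vec S.dX1)
  cov : Fin S.κ0 → Option (Fin S.κ1) → QuadraticForm ℝ (Vec S.dX1)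
  const : Fin S.κ0 → Option (Fin S.κ1) → ℝ≥0∞
  mean_nonneg : ∀ m0 zt x, 0 ≤ mean m0 zt x
  cov_nonneg : ∀ m0 zt x, 0 ≤ cov m0 zt x

/-- The function of `(x⁰, m⁰, θ, z̃)` with the coefficients `K`. -/
def QuadraticValue.eval (K : S.QuadraticValue) (x0 : Vec S.dX0) (m0 : Fin S.κ0)
    (θ : Measure (Vec S.dX1)) (zt : Option (Fin S.κ1)) : ℝ≥0∞ :=
  ENNReal.ofReal (K.mean m0 zt (x0, ∫ x, x ∂θ)) +
    ∫⁻ x, ENNReal.ofReal (K.cov m0 zt (x - ∫ y, y ∂θ)) ∂θ + K.const m0 zt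

/-- `V` is the quadratic value function with the coefficients `K`. -/
def ValueFn.HasCoeffs (V : S.ValueFn) (K : S.QuadraticValue) : Prop :=
  ∀ x0 m0 (θ : Belief S.dX1) zt, V.ext x0 m0 θ.1 zt = K.eval x0 m0 θ.1 zt

theorem ValueFn.exists_hasCoeffs_of_eq_zero {V : S.ValueFn} (hV : ∀ x0 m0 θ zt, V x0 m0 θ zt = 0) :
    ∃ K, V.HasCoeffs K := by
  refine ⟨⟨0, 0, 0, by simp, by simp⟩, fun x0 m0 θ zt => ?_⟩
  simp [V.ext_of_isBelief _ _ θ.2, hV, QuadraticValue.eval]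

theorem QuadraticValue.eval_dirac (K : S.QuadraticValue) (x0 : Vec S.dX0) (m0 : Fin S.κ0)
    (x1 : Vec S.dX1) (zt : Option (Fin S.κ1)) :
    K.eval x0 m0 (Measure.dirac x1) zt =
      ENNReal.ofReal (K.mean m0 zt (x0, x1)) + K.const m0 zt := by
  simp [eval]

section Measurability

variable {A : Type*} [MeasurableSpace A] {f : A → Vec S.dX0} {g : A → Fin S.κ0}
  {z : A → Option (Fin S.κ1)}

theorem QuadraticValue.measurable_eval (K : S.QuadraticValue) (hf : Measurable f)
    (hg : Measurable g) (κ : Kernel A (Vec S.dX1)) [IsMarkovKernel κ] (hz : Measurable z) :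
    Measurable fun a => K.eval (f a) (g a) (κ a) (z a) := by
  have hmean_int : Measurable fun a => ∫ x, x ∂κ a :=
    StronglyMeasurable.integral_kernel (f := fun x : Vec S.dX1 => x) stronglyMeasurable_id
      |>.measurable
  have hmean : Measurable fun a => K.mean (g a) (z a) (f a, ∫ x, x ∂κ a) :=
    measurable_quadraticForm_apply (Function.uncurry K.mean) (hg.prodMk hz) (hf.prodMk hmean_int)
  have hcov : Measurable fun b : A × Vec S.dX1 => K.cov (g b.1) (z b.1) (b.2 - ∫ y, y ∂κ b.1) :=
    measurable_quadraticForm_apply (Function.uncurry K.cov)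
      ((hg.prodMk hz).comp measurable_fst) (measurable_snd.sub (hmean_int.comp measurable_fst))
  have hconst : Measurable (Function.uncurry K.const) := .of_discrete
  exact (hmean.ennreal_ofReal.add hcov.ennreal_ofReal.lintegral_kernel_prod_right').add
    (hconst.comp (hg.prodMk hz))

theorem ValueFn.HasCoeffs.measurable_ext {V : S.ValueFn} {K : S.QuadraticValue}
    (hV : V.HasCoeffs K) (hf : Measurable f) (hg : Measurable g) (κ : Kernel A (Vec S.dX1))
    [IsMarkovKernel κ] (hz : Measurable z) :
    Measurable fun a => V.ext (f a) (g a) (κ a) (z a) := by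
  have hset : MeasurableSet {a | IsBelief (κ a)} := by
    simp only [isBelief_iff_lintegral_lt_top]
    have h : Measurable fun x : Vec S.dX1 => ‖x‖ₑ ^ 2 := by fun_prop
    exact measurableSet_lt h.lintegral_kernel measurable_const
  classical
  have h : (fun a => V.ext (f a) (g a) (κ a) (z a)) =
      fun a => if IsBelief (κ a) then K.eval (f a) (g a) (κ a) (z a) else ∞ := by
    funext a
    split_ifs with ha
    · exact hV (f a) (g a) ⟨κ a, ha⟩ (z a)
    · exact V.ext_of_not_isBelief _ _ ha _
  rw [h]
  exact (K.measurable_eval hf hg κ hz).ite hset measurable_const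

end Measurability

end System

theorem lintegral_prod_assoc {α β γ δ ε : Type*} [MeasurableSpace α] [MeasurableSpace β]
    [MeasurableSpace γ] [MeasurableSpace δ] [MeasurableSpace ε] (μα : Measure α) (μβ : Measure β)
    (μγ : Measure γ) (μδ : Measure δ) (με : Measure ε) [SFinite μβ] [SFinite μγ] [SFinite μδ]
    [SFinite με] {f : (α × β × γ × δ) × ε → ℝ≥0∞} (hf : Measurable f) :
    ∫⁻ a, f ((a.1, a.2.1, a.2.2.1, a.2.2.2.1), a.2.2.2.2)
        ∂(μα.prod (μβ.prod (μγ.prod (μδ.prod με)))) =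
      ∫⁻ b, ∫⁻ e, f (b, e) ∂με ∂(μα.prod (μβ.prod (μγ.prod μδ))) := by
  have hf' : Measurable fun b : α × β × γ × δ => ∫⁻ e, f (b, e) ∂με := hf.lintegral_prod_right'
  rw [lintegral_prod _ (by fun_prop), lintegral_prod _ hf'.aemeasurable]
  refine lintegral_congr fun a => ?_
  rw [lintegral_prod _ (by fun_prop), lintegral_prod _ (by fun_prop)]
  refine lintegral_congr fun b => ?_
  rw [lintegral_prod _ (by fun_prop), lintegral_prod _ (by fun_prop)]
  exact lintegral_congr fun c => lintegral_prod _ (by fun_prop)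

namespace System

variable {S : System}

instance {t : ℕ} [ht : Fact (t ≤ S.T)] : IsProbabilityMeasure (S.πW0 t) :=
  (S.isBelief_πW0 t ht.out).1

instance {t : ℕ} [ht : Fact (t ≤ S.T)] : IsProbabilityMeasure (S.πW1 t) :=
  (S.isBelief_πW1 t ht.out).1

section Definitions

variable (S)

/-- The joint law of `(X¹_t, M¹_t, W⁰_t, W¹_t)` given the common belief `θ` and `z̃`. -/
def plantLaw (t : ℕ) (θ : Measure (Vec S.dX1)) (zt : Option (Fin S.κ1)) :
    Measure (Vec S.dX1 × Fin S.κ1 × Vec S.dX0 × Vec S.dX1) :=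
  θ.prod ((S.modeBelief zt).prod ((S.πW0 t).prod (S.πW1 t)))

/-- The joint law of `(M⁰_{t+1}, M¹_{t+1}, Γ_{t+1})`. -/
def signalLaw : Measure (Fin S.κ0 × Fin S.κ1 × Bool) := S.πM0.prod (S.πM1.prod S.p)

variable {S}

/-- The states and actions at one time as a function of `(X¹_t, M¹_t)`. -/
def stageVec (x0 : Vec S.dX0) (u0 : Vec S.dU0) (ρ : S.Presc) (a : Vec S.dX1 × Fin S.κ1) :
    S.StageVec :=
  ((x0, a.1), (u0, ρ a))

/-- `X⁰_{t+1}` as a function of `(X¹_t, M¹_t, W⁰_t, W¹_t)`. -/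
def nextState0 (x0 : Vec S.dX0) (m0 : Fin S.κ0) (u0 : Vec S.dU0) (ρ : S.Presc)
    (s : Vec S.dX1 × Fin S.κ1 × Vec S.dX0 × Vec S.dX1) : Vec S.dX0 :=
  S.drift0 m0 (stageVec x0 u0 ρ (s.1, s.2.1)) + s.2.2.1

/-- `X¹_{t+1}` as a function of `(X¹_t, M¹_t, W⁰_t, W¹_t)`. -/
def nextState1 (x0 : Vec S.dX0) (m0 : Fin S.κ0) (u0 : Vec S.dU0) (ρ : S.Presc)
    (s : Vec S.dX1 × Fin S.κ1 × Vec S.dX0 × Vec S.dX1) : Vec S.dX1 :=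
  S.drift1 m0 s.2.1 (stageVec x0 u0 ρ (s.1, s.2.1)) + s.2.2.2

variable (S)

/-- The expected instantaneous cost given the common belief `θ` and `z̃`. -/
def stageCost (t : ℕ) (x0 : Vec S.dX0) (m0 : Fin S.κ0) (θ : Measure (Vec S.dX1))
    (zt : Option (Fin S.κ1)) (u0 : Vec S.dU0) (ρ : S.Presc) : ℝ≥0∞ :=
  ∫⁻ a, ENNReal.ofReal (S.costForm t m0 a.2 (stageVec x0 u0 ρ a)) ∂θ.prod (S.modeBelief zt)

/-- The expected cost to go from time `t + 1` on, with `V` in the role of `V_{t+1}`. -/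
def stageNext (t : ℕ) (V : S.ValueFn) (x0 : Vec S.dX0) (m0 : Fin S.κ0)
    (θ : Measure (Vec S.dX1)) (zt : Option (Fin S.κ1)) (u0 : Vec S.dU0) (ρ : S.Presc) : ℝ≥0∞ :=
  ∫⁻ s, ∫⁻ i, V.ext (nextState0 x0 m0 u0 ρ s) i.1
    (S.beliefUpdate t θ u0 ρ x0 m0 zt (channel i.2.2 (nextState1 x0 m0 u0 ρ s)))
    (channel i.2.2 i.2.1) ∂S.signalLaw ∂S.plantLaw t θ zt

end Definitions

variable {t : ℕ} {x0 : Vec S.dX0} {m0 : Fin S.κ0} {θ : Measure (Vec S.dX1)}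
  {zt : Option (Fin S.κ1)} {u0 : Vec S.dU0} {ρ : S.Presc}

instance : IsProbabilityMeasure S.signalLaw := by
  unfold signalLaw
  infer_instance

instance [Fact (t ≤ S.T)] [IsProbabilityMeasure θ] : IsProbabilityMeasure (S.plantLaw t θ zt) := by
  unfold plantLaw
  infer_instance

theorem measurePreserving_plantLaw_local [Fact (t ≤ S.T)] [IsProbabilityMeasure θ] :
    MeasurePreserving (fun s => (s.1, s.2.1)) (S.plantLaw t θ zt) (θ.prod (S.modeBelief zt)) :=
  (MeasurePreserving.id θ).prod measurePreserving_fst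

theorem measurePreserving_plantLaw_noise [Fact (t ≤ S.T)] [IsProbabilityMeasure θ] :
    MeasurePreserving (fun s => s.2.2) (S.plantLaw t θ zt) ((S.πW0 t).prod (S.πW1 t)) :=
  measurePreserving_snd.comp measurePreserving_snd

section Measurability

theorem measurable_stageVec (hρ : Measurable ρ) : Measurable (stageVec x0 u0 ρ) :=
  (measurable_const.prodMk measurable_fst).prodMk (measurable_const.prodMk hρ)

theorem measurable_costForm_stageVec (hρ : Measurable ρ) :
    Measurable fun a => S.costForm t m0 a.2 (stageVec x0 u0 ρ a) :=
  measurable_quadraticForm_apply (S.costForm t m0) measurable_snd (measurable_stageVec hρ)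

theorem measurable_drift1_stageVec (hρ : Measurable ρ) :
    Measurable fun a => S.drift1 m0 a.2 (stageVec x0 u0 ρ a) :=
  measurable_linearMap_apply (S.drift1 m0) measurable_snd (measurable_stageVec hρ)

theorem measurable_nextState0 (hρ : Measurable ρ) : Measurable (nextState0 x0 m0 u0 ρ) :=
  ((S.drift0 m0).continuous_of_finiteDimensional.measurable.comp
    ((measurable_stageVec hρ).comp (by fun_prop))).add (by fun_prop)

theorem measurable_nextState1 (hρ : Measurable ρ) : Measurable (nextState1 x0 m0 u0 ρ) :=
  ((measurable_drift1_stageVec hρ).comp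
    (f := fun s : Vec S.dX1 × Fin S.κ1 × Vec S.dX0 × Vec S.dX1 => (s.1, s.2.1))
    (by fun_prop)).add (by fun_prop)

theorem beliefUpdate_none_eq_map [Fact (t ≤ S.T)] [IsProbabilityMeasure θ] (hρ : Measurable ρ) :
    S.beliefUpdate t θ u0 ρ x0 m0 zt none =
      (S.plantLaw t θ zt).map (nextState1 x0 m0 u0 ρ) := by
  have hdrop : MeasurePreserving (fun s => (s.1, s.2.1, s.2.2.2)) (S.plantLaw t θ zt)
      (θ.prod ((S.modeBelief zt).prod (S.πW1 t))) :=
    (MeasurePreserving.id θ).prod ((MeasurePreserving.id _).prod measurePreserving_snd)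
  have hnext (a : Vec S.dX1 × Fin S.κ1 × Vec S.dX1) :
      S.next1 x0 a.1 m0 a.2.1 u0 (ρ (a.1, a.2.1)) a.2.2 =
        S.drift1 m0 a.2.1 (stageVec x0 u0 ρ (a.1, a.2.1)) + a.2.2 :=
    next1_eq m0 a.2.1 (stageVec x0 u0 ρ (a.1, a.2.1)) a.2.2
  have hmeas : Measurable fun a : Vec S.dX1 × Fin S.κ1 × Vec S.dX1 =>
      S.next1 x0 a.1 m0 a.2.1 u0 (ρ (a.1, a.2.1)) a.2.2 := by
    simp only [hnext]
    exact ((measurable_drift1_stageVec hρ).comp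
      (f := fun a : Vec S.dX1 × Fin S.κ1 × Vec S.dX1 => (a.1, a.2.1)) (by fun_prop)).add
      (by fun_prop)
  rw [beliefUpdate, ← hdrop.map_eq, Measure.map_map hmeas hdrop.measurable]
  simp only [hnext]
  rfl

theorem isProbabilityMeasure_beliefUpdate [Fact (t ≤ S.T)] [IsProbabilityMeasure θ]
    (hρ : Measurable ρ) (z : Option (Vec S.dX1)) :
    IsProbabilityMeasure (S.beliefUpdate t θ u0 ρ x0 m0 zt z) := by
  cases z
  · rw [beliefUpdate_none_eq_map hρ]
    exact Measure.isProbabilityMeasure_map (measurable_nextState1 hρ).aemeasurable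
  · exact Measure.dirac.isProbabilityMeasure

end Measurability

end System

namespace System

variable {S : System} {t : ℕ} {x0 : Vec S.dX0} {m0 : Fin S.κ0} {θ : Measure (Vec S.dX1)}
  {zt : Option (Fin S.κ1)} {u0 : Vec S.dU0} {ρ : S.Presc} {V : S.ValueFn} {K : S.QuadraticValue}

section Split

variable [Fact (t ≤ S.T)] [IsProbabilityMeasure θ]

theorem measurable_ext_beliefUpdate (hV : V.HasCoeffs K) (hρ : Measurable ρ) :
    Measurable fun b : (Vec S.dX1 × Fin S.κ1 × Vec S.dX0 × Vec S.dX1) ×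
        (Fin S.κ0 × Fin S.κ1 × Bool) =>
      V.ext (nextState0 x0 m0 u0 ρ b.1) b.2.1
        (S.beliefUpdate t θ u0 ρ x0 m0 zt (channel b.2.2.2 (nextState1 x0 m0 u0 ρ b.1)))
        (channel b.2.2.2 b.2.2.1) := by
  let η : Kernel (Option (Vec S.dX1)) (Vec S.dX1) :=
    ⟨S.beliefUpdate t θ u0 ρ x0 m0 zt, measurable_of_some Measure.measurable_dirac⟩
  have : IsMarkovKernel η := ⟨isProbabilityMeasure_beliefUpdate hρ⟩
  have hz : Measurable fun b : (Vec S.dX1 × Fin S.κ1 × Vec S.dX0 × Vec S.dX1) ×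
      (Fin S.κ0 × Fin S.κ1 × Bool) => channel b.2.2.2 (nextState1 x0 m0 u0 ρ b.1) :=
    measurable_channel measurable_snd.snd.snd ((measurable_nextState1 hρ).comp measurable_fst)
  exact hV.measurable_ext ((measurable_nextState0 hρ).comp measurable_fst) measurable_snd.fst
    (η.comap _ hz) (measurable_channel measurable_snd.snd.snd measurable_snd.snd.fst)

theorem lintegral_costForm_plantLaw (hρ : Measurable ρ) :
    ∫⁻ s, ENNReal.ofReal (S.costForm t m0 s.2.1 (stageVec x0 u0 ρ (s.1, s.2.1)))
      ∂S.plantLaw t θ zt = S.stageCost t x0 m0 θ zt u0 ρ :=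
  measurePreserving_plantLaw_local.lintegral_comp (measurable_costForm_stageVec hρ).ennreal_ofReal

theorem stageValue_eq_add (hV : V.HasCoeffs K) (hρ : Measurable ρ) :
    S.stageValue t V x0 m0 θ zt u0 ρ =
      S.stageCost t x0 m0 θ zt u0 ρ + S.stageNext t V x0 m0 θ zt u0 ρ := by
  let c (s : Vec S.dX1 × Fin S.κ1 × Vec S.dX0 × Vec S.dX1) : ℝ≥0∞ :=
    ENNReal.ofReal (S.costForm t m0 s.2.1 (stageVec x0 u0 ρ (s.1, s.2.1)))
  let v (b : (Vec S.dX1 × Fin S.κ1 × Vec S.dX0 × Vec S.dX1) × (Fin S.κ0 × Fin S.κ1 × Bool)) :=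
    V.ext (nextState0 x0 m0 u0 ρ b.1) b.2.1
      (S.beliefUpdate t θ u0 ρ x0 m0 zt (channel b.2.2.2 (nextState1 x0 m0 u0 ρ b.1)))
      (channel b.2.2.2 b.2.2.1)
  have hc : Measurable c :=
    ((measurable_costForm_stageVec hρ).comp
      (f := fun s : Vec S.dX1 × Fin S.κ1 × Vec S.dX0 × Vec S.dX1 => (s.1, s.2.1))
      (by fun_prop)).ennreal_ofReal
  have hv : Measurable v := measurable_ext_beliefUpdate hV hρ
  calc S.stageValue t V x0 m0 θ zt u0 ρ
      = ∫⁻ a, (c (a.1, a.2.1, a.2.2.1, a.2.2.2.1) +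
          v ((a.1, a.2.1, a.2.2.1, a.2.2.2.1), a.2.2.2.2))
          ∂(θ.prod ((S.modeBelief zt).prod ((S.πW0 t).prod ((S.πW1 t).prod S.signalLaw)))) := by
        refine lintegral_congr fun a => ?_
        simp only [c, v, nextState0, nextState1, ← next0_eq, ← next1_eq, ← cost_eq, stageVec]
    _ = ∫⁻ s, ∫⁻ i, (c s + v (s, i)) ∂S.signalLaw ∂S.plantLaw t θ zt :=
        lintegral_prod_assoc _ _ _ _ _ (f := fun b => c b.1 + v b)
          ((hc.comp measurable_fst).add hv)
    _ = ∫⁻ s, c s ∂S.plantLaw t θ zt + ∫⁻ s, ∫⁻ i, v (s, i) ∂S.signalLaw ∂S.plantLaw t θ zt := by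
        simp only [lintegral_add_left measurable_const, lintegral_const, measure_univ, mul_one]
        exact lintegral_add_left hc _
    _ = S.stageCost t x0 m0 θ zt u0 ρ + S.stageNext t V x0 m0 θ zt u0 ρ := by
        rw [lintegral_costForm_plantLaw hρ]
        rfl

end Split

section SquareIntegrable

theorem memLp_presc_of_stageCost_ne_top [ht : Fact (t ≤ S.T)] (hρ : Measurable ρ)
    (h : S.stageCost t x0 m0 θ zt u0 ρ ≠ ∞) : MemLp ρ 2 (θ.prod (S.modeBelief zt)) := by
  obtain ⟨C, hC⟩ := exists_norm_action_sq_le_mul_costForm ht.out m0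
  have hcost : Integrable (fun a => S.costForm t m0 a.2 (stageVec x0 u0 ρ a))
      (θ.prod (S.modeBelief zt)) :=
    (lintegral_ofReal_ne_top_iff_integrable (measurable_costForm_stageVec hρ).aestronglyMeasurable
      (ae_of_all _ fun a => costForm_nonneg ht.out _ _ _)).1 h
  refine (memLp_two_iff_integrable_sq_norm hρ.aestronglyMeasurable).2
    ((hcost.const_mul C).mono' (hρ.norm.pow_const 2).aestronglyMeasurable
      (ae_of_all _ fun a => ?_))
  rw [norm_pow, norm_norm]
  exact hC a.2 (stageVec x0 u0 ρ a)

theorem memLp_stageVec [IsProbabilityMeasure θ] (hθ : MemLp id 2 θ)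
    (hρ : MemLp ρ 2 (θ.prod (S.modeBelief zt))) :
    MemLp (stageVec x0 u0 ρ) 2 (θ.prod (S.modeBelief zt)) :=
  .of_fst_snd ⟨.of_fst_snd ⟨memLp_const x0, hθ.comp_measurePreserving measurePreserving_fst⟩,
    .of_fst_snd ⟨memLp_const u0, hρ⟩⟩

theorem memLp_drift1_stageVec [IsProbabilityMeasure θ] (hθ : MemLp id 2 θ) (hρ : Measurable ρ)
    (hρ2 : MemLp ρ 2 (θ.prod (S.modeBelief zt))) :
    MemLp (fun a => S.drift1 m0 a.2 (stageVec x0 u0 ρ a)) 2 (θ.prod (S.modeBelief zt)) := by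
  let L (m1 : Fin S.κ1) := (S.drift1 m0 m1).toContinuousLinearMap
  refine (memLp_stageVec (x0 := x0) (u0 := u0) hθ hρ2).of_le_mul (c := ∑ m1, ‖L m1‖)
    (measurable_drift1_stageVec hρ).aestronglyMeasurable (ae_of_all _ fun a => ?_)
  exact ((L a.2).le_opNorm _).trans (mul_le_mul_of_nonneg_right
    (Finset.single_le_sum (f := fun m1 => ‖L m1‖) (fun _ _ => norm_nonneg _)
      (Finset.mem_univ a.2)) (norm_nonneg _))

variable [ht : Fact (t ≤ S.T)]

theorem memLp_nextState1 [IsProbabilityMeasure θ] (hθ : MemLp id 2 θ) (hρ : Measurable ρ)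
    (hρ2 : MemLp ρ 2 (θ.prod (S.modeBelief zt))) :
    MemLp (nextState1 x0 m0 u0 ρ) 2 (S.plantLaw t θ zt) :=
  ((memLp_drift1_stageVec hθ hρ hρ2).comp_measurePreserving measurePreserving_plantLaw_local).add
    ((S.isBelief_πW1 t ht.out).2.comp_measurePreserving
      (measurePreserving_snd.comp measurePreserving_plantLaw_noise))

theorem isBelief_beliefUpdate (hθ : IsBelief θ) (hρ : Measurable ρ)
    (hρ2 : MemLp ρ 2 (θ.prod (S.modeBelief zt))) (z : Option (Vec S.dX1)) :
    IsBelief (S.beliefUpdate t θ u0 ρ x0 m0 zt z) := by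
  have := hθ.1
  cases z with
  | none =>
    refine ⟨isProbabilityMeasure_beliefUpdate hρ none, ?_⟩
    rw [beliefUpdate_none_eq_map hρ]
    exact (memLp_map_measure_iff (by fun_prop) (measurable_nextState1 hρ).aemeasurable).2
      (memLp_nextState1 hθ.2 hρ hρ2)
  | some x1 => exact isBelief_dirac x1

theorem stageValue_eq_stageCost (hV : ∀ x0 m0 θ zt, V x0 m0 θ zt = 0) (hθ : IsBelief θ)
    (hρ : Measurable ρ) : S.stageValue t V x0 m0 θ zt u0 ρ = S.stageCost t x0 m0 θ zt u0 ρ := by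
  have := hθ.1
  obtain ⟨K, hcoeffs⟩ := ValueFn.exists_hasCoeffs_of_eq_zero hV
  rw [stageValue_eq_add hcoeffs hρ]
  by_cases hcost : S.stageCost t x0 m0 θ zt u0 ρ = ∞
  · rw [hcost, top_add]
  have hρ2 := memLp_presc_of_stageCost_ne_top hρ hcost
  have hnext : S.stageNext t V x0 m0 θ zt u0 ρ = 0 := by
    simp [stageNext, V.ext_of_isBelief _ _ (isBelief_beliefUpdate hθ hρ hρ2 _), hV]
  rw [hnext, add_zero]

end SquareIntegrable

end System

namespace System

variable {S : System}

section NextForm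

/-- The cost to go `K` at time `t + 1`, as a quadratic form in `((X⁰_{t+1}, X¹_{t+1}), y)` for given
`(M⁰_{t+1}, M¹_{t+1}, Γ_{t+1})`, where `y` is the mean of the belief update without reception. The
covariance of that update enters through the square of `X¹_{t+1} - y`, whose law it is. -/
def QuadraticValue.nextForm (K : S.QuadraticValue) (i : Fin S.κ0 × Fin S.κ1 × Bool) :
    QuadraticForm ℝ ((Vec S.dX0 × Vec S.dX1) × Vec S.dX1) :=
  if i.2.2 then (K.mean i.1 (some i.2.1)).comp (LinearMap.fst ℝ _ _)
  else (K.mean i.1 none).comp ((LinearMap.fst ℝ _ _).prodMap LinearMap.id) +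
    (K.cov i.1 none).comp (LinearMap.snd ℝ _ _ ∘ₗ LinearMap.fst ℝ _ _ - LinearMap.snd ℝ _ _)

theorem QuadraticValue.nextForm_nonneg (K : S.QuadraticValue) (i : Fin S.κ0 × Fin S.κ1 × Bool)
    (v : (Vec S.dX0 × Vec S.dX1) × Vec S.dX1) : 0 ≤ K.nextForm i v := by
  unfold nextForm
  split_ifs
  · exact K.mean_nonneg _ _ _
  · exact add_nonneg (K.mean_nonneg _ _ _) (K.cov_nonneg _ _ _)

variable (t : ℕ) (m0 : Fin S.κ0) (K : S.QuadraticValue) (m1 : Fin S.κ1)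

/-- The instantaneous cost plus the expected quadratic part of the cost to go, as a quadratic form
in the states and actions, the noises, and the mean of the belief update without reception. -/
def stageForm : QuadraticForm ℝ (S.StageVec × (Vec S.dX0 × Vec S.dX1) × Vec S.dX1) :=
  (S.costForm t m0 m1).comp (LinearMap.fst ℝ _ _) +
    (averageForm S.signalLaw K.nextForm).comp
      ((((S.drift0 m0).prod (S.drift1 m0 m1)).coprod LinearMap.id).prodMap LinearMap.id ∘ₗ
        (LinearEquiv.prodAssoc ℝ _ _ _).symm.toLinearMap)

theorem stageForm_apply (v : S.StageVec) (w : Vec S.dX0 × Vec S.dX1) (y : Vec S.dX1) :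
    stageForm t m0 K m1 (v, w, y) = S.costForm t m0 m1 v +
      averageForm S.signalLaw K.nextForm ((S.drift0 m0 v + w.1, S.drift1 m0 m1 v + w.2), y) :=
  rfl

variable {t} in
theorem stageForm_nonneg (ht : t ≤ S.T)
    (b : S.StageVec × (Vec S.dX0 × Vec S.dX1) × Vec S.dX1) : 0 ≤ stageForm t m0 K m1 b :=
  add_nonneg (costForm_nonneg ht m0 m1 _) (averageForm_nonneg K.nextForm_nonneg _)

end NextForm

variable {t : ℕ} {x0 : Vec S.dX0} {m0 : Fin S.κ0} {θ : Measure (Vec S.dX1)}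
  {zt : Option (Fin S.κ1)} {u0 : Vec S.dU0} {ρ : S.Presc} {V : S.ValueFn} {K : S.QuadraticValue}
  [ht : Fact (t ≤ S.T)]

section Gather

theorem lintegral_ext_beliefUpdate (hV : V.HasCoeffs K) (hθ : IsBelief θ) (hρ : Measurable ρ)
    (hρ2 : MemLp ρ 2 (θ.prod (S.modeBelief zt))) {y : Vec S.dX1}
    (hy : ∫ s, nextState1 x0 m0 u0 ρ s ∂S.plantLaw t θ zt = y)
    (i : Fin S.κ0 × Fin S.κ1 × Bool) :
    ∫⁻ s, V.ext (nextState0 x0 m0 u0 ρ s) i.1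
        (S.beliefUpdate t θ u0 ρ x0 m0 zt (channel i.2.2 (nextState1 x0 m0 u0 ρ s)))
        (channel i.2.2 i.2.1) ∂S.plantLaw t θ zt =
      ∫⁻ s, ENNReal.ofReal
          (K.nextForm i ((nextState0 x0 m0 u0 ρ s, nextState1 x0 m0 u0 ρ s), y))
          ∂S.plantLaw t θ zt + K.const i.1 (channel i.2.2 i.2.1) := by
  have := hθ.1
  obtain ⟨m0', m1', γ⟩ := i
  have hext (s) := hV (nextState0 x0 m0 u0 ρ s) m0'
    ⟨_, isBelief_beliefUpdate (t := t) (x0 := x0) (m0 := m0) (u0 := u0) hθ hρ hρ2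
      (channel γ (nextState1 x0 m0 u0 ρ s))⟩ (channel γ m1')
  simp only [hext]
  cases γ with
  | true =>
    simp only [channel, beliefUpdate, if_true, QuadraticValue.eval_dirac]
    rw [lintegral_add_right _ measurable_const]
    simp [QuadraticValue.nextForm]
  | false =>
    have hmean : ∫ x, x ∂S.beliefUpdate t θ u0 ρ x0 m0 zt none = y := by
      rw [beliefUpdate_none_eq_map hρ, integral_map (measurable_nextState1 hρ).aemeasurable
        (by fun_prop), hy]
    have hcov : ∫⁻ x, ENNReal.ofReal (K.cov m0' none (x - y))
        ∂S.beliefUpdate t θ u0 ρ x0 m0 zt none =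
        ∫⁻ s, ENNReal.ofReal (K.cov m0' none (nextState1 x0 m0 u0 ρ s - y)) ∂S.plantLaw t θ zt := by
      rw [beliefUpdate_none_eq_map hρ, lintegral_map _ (measurable_nextState1 hρ)]
      exact ((continuous_quadraticForm _).measurable.comp
        (measurable_id.sub_const y)).ennreal_ofReal
    have hmeas : Measurable fun s =>
        ENNReal.ofReal (K.mean m0' none (nextState0 x0 m0 u0 ρ s, y)) :=
      ((continuous_quadraticForm _).measurable.comp
        ((measurable_nextState0 hρ).prodMk measurable_const)).ennreal_ofReal
    simp only [channel, Bool.false_eq_true, if_false, QuadraticValue.eval, hmean, hcov]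
    rw [lintegral_add_right _ measurable_const, lintegral_add_right _ measurable_const]
    simp only [lintegral_const, measure_univ, mul_one]
    rw [← lintegral_add_left hmeas]
    congr 1
    refine lintegral_congr fun s => ?_
    rw [← ENNReal.ofReal_add (K.mean_nonneg _ _ _) (K.cov_nonneg _ _ _)]
    simp [QuadraticValue.nextForm]

theorem stageNext_eq (hV : V.HasCoeffs K) (hθ : IsBelief θ) (hρ : Measurable ρ)
    (hρ2 : MemLp ρ 2 (θ.prod (S.modeBelief zt))) {y : Vec S.dX1}
    (hy : ∫ s, nextState1 x0 m0 u0 ρ s ∂S.plantLaw t θ zt = y) :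
    S.stageNext t V x0 m0 θ zt u0 ρ =
      ∫⁻ s, ENNReal.ofReal (averageForm S.signalLaw K.nextForm
        ((nextState0 x0 m0 u0 ρ s, nextState1 x0 m0 u0 ρ s), y)) ∂S.plantLaw t θ zt +
      ∫⁻ i, K.const i.1 (channel i.2.2 i.2.1) ∂S.signalLaw := by
  have := hθ.1
  have hform : Measurable fun b : (Fin S.κ0 × Fin S.κ1 × Bool) × _ =>
      ENNReal.ofReal (K.nextForm b.1 ((nextState0 x0 m0 u0 ρ b.2, nextState1 x0 m0 u0 ρ b.2), y)) :=
    (measurable_quadraticForm_apply K.nextForm measurable_fst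
      ((((measurable_nextState0 hρ).comp measurable_snd).prodMk
        ((measurable_nextState1 hρ).comp measurable_snd)).prodMk
          measurable_const)).ennreal_ofReal
  rw [stageNext, lintegral_lintegral_swap (measurable_ext_beliefUpdate hV hρ).aemeasurable]
  simp only [lintegral_ext_beliefUpdate hV hθ hρ hρ2 hy, ofReal_averageForm K.nextForm_nonneg]
  rw [lintegral_add_right _ (Measurable.of_discrete), lintegral_lintegral_swap hform.aemeasurable]

theorem stageValue_eq_lintegral_stageForm (hV : V.HasCoeffs K) (hθ : IsBelief θ)
    (hρ : Measurable ρ) (hρ2 : MemLp ρ 2 (θ.prod (S.modeBelief zt))) {y : Vec S.dX1}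
    (hy : ∫ s, nextState1 x0 m0 u0 ρ s ∂S.plantLaw t θ zt = y) :
    S.stageValue t V x0 m0 θ zt u0 ρ =
      ∫⁻ s, ENNReal.ofReal (stageForm t m0 K s.2.1 (stageVec x0 u0 ρ (s.1, s.2.1), s.2.2, y))
        ∂S.plantLaw t θ zt + ∫⁻ i, K.const i.1 (channel i.2.2 i.2.1) ∂S.signalLaw := by
  have := hθ.1
  have hcost : Measurable fun s : Vec S.dX1 × Fin S.κ1 × Vec S.dX0 × Vec S.dX1 =>
      ENNReal.ofReal (S.costForm t m0 s.2.1 (stageVec x0 u0 ρ (s.1, s.2.1))) :=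
    ((measurable_costForm_stageVec hρ).comp
      (f := fun s : Vec S.dX1 × Fin S.κ1 × Vec S.dX0 × Vec S.dX1 => (s.1, s.2.1))
      (by fun_prop)).ennreal_ofReal
  rw [stageValue_eq_add hV hρ, stageNext_eq hV hθ hρ hρ2 hy, ← lintegral_costForm_plantLaw hρ,
    ← add_assoc, ← lintegral_add_left hcost]
  congr 1
  refine lintegral_congr fun s => ?_
  rw [stageForm_apply, ENNReal.ofReal_add (costForm_nonneg ht.out _ _ _)
    (averageForm_nonneg K.nextForm_nonneg _)]
  rfl

end Gather

end System

namespace System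

variable {S : System}

section Definitions

variable (S) in
/-- The means at one time, in the order `((x⁰, x̄¹), (u⁰, ū¹))`, where `ū¹` is the mean of the
local action for each value of the local mode. -/
abbrev MeanVec : Type := (Vec S.dX0 × Vec S.dX1) × (Vec S.dU0 × (Fin S.κ1 → Vec S.dU1))

/-- The mean of the states and actions given the local mode `m1`. -/
def meanStage (m1 : Fin S.κ1) : S.MeanVec →ₗ[ℝ] S.StageVec :=
  LinearMap.id.prodMap (LinearMap.id.prodMap (LinearMap.proj m1))

variable (S) in
/-- The embedding of the deviations of `(X¹_t, U¹_t)` from their means into the states and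
actions. -/
def devStage : Vec S.dX1 × Vec S.dU1 →ₗ[ℝ] S.StageVec :=
  (LinearMap.inr ℝ _ _).prodMap (LinearMap.inr ℝ _ _)

/-- The mean of the belief update without reception. -/
def predictMean (m0 : Fin S.κ0) (zt : Option (Fin S.κ1)) : S.MeanVec →ₗ[ℝ] Vec S.dX1 :=
  ∑ m1, (S.modeBelief zt).real {m1} • (S.drift1 m0 m1 ∘ₗ meanStage m1)

variable (t : ℕ) (m0 : Fin S.κ0) (K : S.QuadraticValue)

/-- The part of the stage value that depends on the means. -/
def meanForm (zt : Option (Fin S.κ1)) : QuadraticForm ℝ S.MeanVec :=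
  averageForm (S.modeBelief zt) fun m1 =>
    (stageForm t m0 K m1).comp ((meanStage m1).prod (LinearMap.prod 0 (predictMean m0 zt)))

/-- The cost of the deviations of `(X¹_t, U¹_t)` from their means given the local mode `m1`. -/
def devForm (m1 : Fin S.κ1) : QuadraticForm ℝ (Vec S.dX1 × Vec S.dU1) :=
  (stageForm t m0 K m1).comp (LinearMap.inl ℝ _ _ ∘ₗ S.devStage)

/-- The part of the stage value that depends neither on the states nor on the actions. -/
def noiseCost (zt : Option (Fin S.κ1)) : ℝ≥0∞ :=
  ∫⁻ m1, ∫⁻ w, ENNReal.ofReal (stageForm t m0 K m1 (0, w, 0)) ∂(S.πW0 t).prod (S.πW1 t)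
      ∂S.modeBelief zt +
    ∫⁻ i, K.const i.1 (channel i.2.2 i.2.1) ∂S.signalLaw

/-- The mean local action `∫ ρ(x, m) θ(dx)` under a prescription `ρ`, for each local mode `m`. -/
def meanAction (θ : Measure (Vec S.dX1)) (ρ : S.Presc) (m1 : Fin S.κ1) : Vec S.dU1 :=
  ∫ x, ρ (x, m1) ∂θ

/-- The deviation of `(X¹_t, U¹_t)` from its mean given the local mode `m1`. -/
def deviation (θ : Measure (Vec S.dX1)) (ρ : S.Presc) (m1 : Fin S.κ1) (x : Vec S.dX1) :
    Vec S.dX1 × Vec S.dU1 :=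
  (x - ∫ y, y ∂θ, ρ (x, m1) - meanAction θ ρ m1)

end Definitions

variable {t : ℕ} {x0 : Vec S.dX0} {m0 : Fin S.κ0} {θ : Measure (Vec S.dX1)}
  {zt : Option (Fin S.κ1)} {u0 : Vec S.dU0} {ρ : S.Presc} {V : S.ValueFn} {K : S.QuadraticValue}

theorem meanForm_nonneg [ht : Fact (t ≤ S.T)] (z : S.MeanVec) : 0 ≤ meanForm t m0 K zt z :=
  averageForm_nonneg (fun m1 _ => by exact stageForm_nonneg m0 K m1 ht.out _) z

theorem devForm_nonneg [ht : Fact (t ≤ S.T)] {m1 : Fin S.κ1} (z : Vec S.dX1 × Vec S.dU1) :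
    0 ≤ devForm t m0 K m1 z :=
  stageForm_nonneg m0 K m1 ht.out _

section Deviation

theorem stageVec_eq_add (x : Vec S.dX1) (m1 : Fin S.κ1) :
    stageVec x0 u0 ρ (x, m1) =
      meanStage m1 ((x0, ∫ y, y ∂θ), (u0, meanAction θ ρ)) +
        S.devStage (deviation θ ρ m1 x) := by
  simp [stageVec, meanStage, devStage, deviation]

variable [IsProbabilityMeasure θ] {m1 : Fin S.κ1}

theorem memLp_deviation (hθ : MemLp id 2 θ) (hρ : MemLp (fun x => ρ (x, m1)) 2 θ) :
    MemLp (deviation θ ρ m1) 2 θ :=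
  .of_fst_snd ⟨hθ.sub (memLp_const _), hρ.sub (memLp_const _)⟩

theorem integral_deviation (hθ : MemLp id 2 θ) (hρ : MemLp (fun x => ρ (x, m1)) 2 θ) :
    ∫ x, deviation θ ρ m1 x ∂θ = 0 := by
  have hθi : Integrable (fun x => x) θ := hθ.integrable one_le_two
  have hρi : Integrable (fun x => ρ (x, m1)) θ := hρ.integrable one_le_two
  have hstate : ∫ x, (x - ∫ y, y ∂θ) ∂θ = 0 := by
    rw [integral_sub hθi (integrable_const _)]
    simp
  have haction : ∫ x, (ρ (x, m1) - meanAction θ ρ m1) ∂θ = 0 := by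
    rw [integral_sub hρi (integrable_const _)]
    simp [meanAction]
  exact (integral_pair (hθi.sub (integrable_const _)) (hρi.sub (integrable_const _))).trans
    (Prod.ext hstate haction)

theorem ae_memLp_section (hρ : Measurable ρ) (hρ2 : MemLp ρ 2 (θ.prod (S.modeBelief zt))) :
    ∀ᵐ m1 ∂S.modeBelief zt, MemLp (fun x => ρ (x, m1)) 2 θ := by
  have h : Integrable (fun a => ‖ρ a‖ ^ 2) (θ.prod (S.modeBelief zt)) :=
    (memLp_two_iff_integrable_sq_norm hρ.aestronglyMeasurable).1 hρ2
  filter_upwards [h.prod_left_ae] with m1 hm1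
  exact (memLp_two_iff_integrable_sq_norm
    (hρ.comp measurable_prodMk_right).aestronglyMeasurable).2 hm1

theorem integral_drift1_stageVec (hθ : MemLp id 2 θ) (hρ : MemLp (fun x => ρ (x, m1)) 2 θ) :
    ∫ x, S.drift1 m0 m1 (stageVec x0 u0 ρ (x, m1)) ∂θ =
      S.drift1 m0 m1 (meanStage m1 ((x0, ∫ y, y ∂θ), (u0, meanAction θ ρ))) := by
  let L := (S.drift1 m0 m1 ∘ₗ S.devStage).toContinuousLinearMap
  have hdev := (memLp_deviation hθ hρ).integrable one_le_two
  have hL : ∫ x, L (deviation θ ρ m1 x) ∂θ = 0 := by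
    rw [L.integral_comp_comm hdev, integral_deviation hθ hρ, map_zero]
  simp only [stageVec_eq_add (θ := θ), map_add]
  refine (integral_add (integrable_const _) (L.integrable_comp hdev)).trans ?_
  rw [hL, add_zero, integral_const, probReal_univ, one_smul]

theorem integral_nextState1 [ht : Fact (t ≤ S.T)] (hθ : MemLp id 2 θ) (hρ : Measurable ρ)
    (hρ2 : MemLp ρ 2 (θ.prod (S.modeBelief zt))) :
    ∫ s, nextState1 x0 m0 u0 ρ s ∂S.plantLaw t θ zt =
      predictMean m0 zt ((x0, ∫ y, y ∂θ), (u0, meanAction θ ρ)) := by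
  have hlocal := measurePreserving_plantLaw_local (t := t) (θ := θ) (zt := zt)
  have hnoise := measurePreserving_snd.comp (measurePreserving_plantLaw_noise (t := t) (θ := θ)
    (zt := zt))
  have hdrift := (memLp_drift1_stageVec (x0 := x0) (m0 := m0) (u0 := u0) hθ hρ hρ2).integrable
    one_le_two
  have hW1 : Integrable (fun w => w) (S.πW1 t) := (S.isBelief_πW1 t ht.out).2.integrable one_le_two
  have hnoise0 : ∫ s, s.2.2.2 ∂S.plantLaw t θ zt = 0 := by
    rw [← S.mean_πW1 t ht.out, ← hnoise.map_eq, integral_map hnoise.aemeasurable (by fun_prop)]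
    rfl
  calc ∫ s, nextState1 x0 m0 u0 ρ s ∂S.plantLaw t θ zt
      = ∫ s, S.drift1 m0 s.2.1 (stageVec x0 u0 ρ (s.1, s.2.1)) ∂S.plantLaw t θ zt +
          ∫ s, s.2.2.2 ∂S.plantLaw t θ zt :=
        integral_add (hlocal.integrable_comp_of_integrable hdrift)
          (hnoise.integrable_comp_of_integrable hW1)
    _ = ∫ a, S.drift1 m0 a.2 (stageVec x0 u0 ρ a) ∂θ.prod (S.modeBelief zt) := by
        rw [hnoise0, add_zero, ← hlocal.map_eq, integral_map hlocal.aemeasurable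
          (measurable_drift1_stageVec hρ).aestronglyMeasurable]
    _ = ∫ m1, S.drift1 m0 m1 (meanStage m1 ((x0, ∫ y, y ∂θ), (u0, meanAction θ ρ)))
          ∂S.modeBelief zt := by
        rw [integral_prod_symm _ hdrift]
        exact integral_congr_ae
          ((ae_memLp_section hρ hρ2).mono fun _ => integral_drift1_stageVec hθ)
    _ = predictMean m0 zt ((x0, ∫ y, y ∂θ), (u0, meanAction θ ρ)) := by
        rw [integral_fintype .of_finite]
        simp [predictMean]

end Deviation

section BiasVariance

theorem measurable_stageForm_stageVec (hρ : Measurable ρ) (y : Vec S.dX1) :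
    Measurable fun b : (Vec S.dX1 × Fin S.κ1) × (Vec S.dX0 × Vec S.dX1) =>
      ENNReal.ofReal (stageForm t m0 K b.1.2 (stageVec x0 u0 ρ b.1, b.2, y)) :=
  (measurable_quadraticForm_apply (stageForm t m0 K) measurable_fst.snd
    (((measurable_stageVec hρ).comp measurable_fst).prodMk
      (measurable_snd.prodMk measurable_const))).ennreal_ofReal

variable [ht : Fact (t ≤ S.T)]

theorem lintegral_stageForm_noise (m1 : Fin S.κ1) (v : S.StageVec) (y : Vec S.dX1) :
    ∫⁻ w, ENNReal.ofReal (stageForm t m0 K m1 (v, w, y)) ∂(S.πW0 t).prod (S.πW1 t) =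
      ENNReal.ofReal (stageForm t m0 K m1 (v, 0, y)) +
        ∫⁻ w, ENNReal.ofReal (stageForm t m0 K m1 (0, w, 0)) ∂(S.πW0 t).prod (S.πW1 t) := by
  have hW : MemLp (fun w : Vec S.dX0 × Vec S.dX1 => w) 2 ((S.πW0 t).prod (S.πW1 t)) :=
    .of_fst_snd ⟨(S.isBelief_πW0 t ht.out).2.comp_measurePreserving measurePreserving_fst,
      (S.isBelief_πW1 t ht.out).2.comp_measurePreserving measurePreserving_snd⟩
  have hW0 : ∫ w, w ∂(S.πW0 t).prod (S.πW1 t) = 0 := by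
    have hi := hW.integrable one_le_two
    refine Prod.ext ?_ ?_
    · rw [fst_integral hi, integral_fun_fst (fun w : Vec S.dX0 => w)]
      simp [S.mean_πW0 t ht.out]
    · rw [snd_integral hi, integral_fun_snd (fun w : Vec S.dX1 => w)]
      simp [S.mean_πW1 t ht.out]
  let J : Vec S.dX0 × Vec S.dX1 →L[ℝ] S.StageVec × (Vec S.dX0 × Vec S.dX1) × Vec S.dX1 :=
    (ContinuousLinearMap.inr ℝ _ _).comp (ContinuousLinearMap.inl ℝ _ _)
  have hJ0 : ∫ w, J w ∂(S.πW0 t).prod (S.πW1 t) = 0 := by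
    rw [J.integral_comp_comm (hW.integrable one_le_two), hW0, map_zero]
  have h := lintegral_quadraticForm_const_add (stageForm_nonneg m0 K m1 ht.out)
    (J.comp_memLp' hW) hJ0 (v, 0, y)
  simpa [J] using h

theorem lintegral_stageForm_stageVec [IsProbabilityMeasure θ] (hθ : MemLp id 2 θ) {m1 : Fin S.κ1}
    (hρ : MemLp (fun x => ρ (x, m1)) 2 θ) (y : Vec S.dX1) :
    ∫⁻ x, ENNReal.ofReal (stageForm t m0 K m1 (stageVec x0 u0 ρ (x, m1), 0, y)) ∂θ =
      ENNReal.ofReal (stageForm t m0 K m1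
          (meanStage m1 ((x0, ∫ y, y ∂θ), (u0, meanAction θ ρ)), 0, y)) +
        ∫⁻ x, ENNReal.ofReal (devForm t m0 K m1 (deviation θ ρ m1 x)) ∂θ := by
  let J : Vec S.dX1 × Vec S.dU1 →L[ℝ] S.StageVec × (Vec S.dX0 × Vec S.dX1) × Vec S.dX1 :=
    (LinearMap.inl ℝ _ _ ∘ₗ S.devStage).toContinuousLinearMap
  have hdev := memLp_deviation hθ hρ
  have hJ0 : ∫ x, J (deviation θ ρ m1 x) ∂θ = 0 := by
    rw [J.integral_comp_comm (hdev.integrable one_le_two), integral_deviation hθ hρ, map_zero]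
  have h := lintegral_quadraticForm_const_add (stageForm_nonneg m0 K m1 ht.out)
    (J.comp_memLp' hdev) hJ0 (meanStage m1 ((x0, ∫ y, y ∂θ), (u0, meanAction θ ρ)), 0, y)
  simpa [J, stageVec_eq_add (θ := θ), devForm] using h

theorem lintegral_plantLaw [IsProbabilityMeasure θ]
    {f : (Vec S.dX1 × Fin S.κ1) × (Vec S.dX0 × Vec S.dX1) → ℝ≥0∞} (hf : Measurable f) :
    ∫⁻ s, f ((s.1, s.2.1), s.2.2) ∂S.plantLaw t θ zt =
      ∫⁻ m1, ∫⁻ x, ∫⁻ w, f ((x, m1), w) ∂(S.πW0 t).prod (S.πW1 t) ∂θ ∂S.modeBelief zt := by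
  have h : Measurable fun a => ∫⁻ w, f (a, w) ∂(S.πW0 t).prod (S.πW1 t) :=
    hf.lintegral_prod_right'
  rw [← lintegral_prod_symm _ h.aemeasurable, ← lintegral_prod _ hf.aemeasurable]
  exact (measurePreserving_prodAssoc θ (S.modeBelief zt)
    ((S.πW0 t).prod (S.πW1 t))).symm.lintegral_comp hf

theorem ofReal_meanForm (v : S.MeanVec) :
    ENNReal.ofReal (meanForm t m0 K zt v) = ∫⁻ m1, ENNReal.ofReal
      (stageForm t m0 K m1 (meanStage m1 v, 0, predictMean m0 zt v)) ∂S.modeBelief zt := by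
  rw [meanForm, ofReal_averageForm]
  · simp only [QuadraticMap.comp_apply, LinearMap.prod_apply, Function.prod_apply,
      LinearMap.zero_apply]
  · exact fun m1 _ => stageForm_nonneg m0 K m1 ht.out _

theorem stageValue_eq_meanForm_add (hV : V.HasCoeffs K) (hθ : IsBelief θ) (hρ : Measurable ρ)
    (hρ2 : MemLp ρ 2 (θ.prod (S.modeBelief zt))) :
    S.stageValue t V x0 m0 θ zt u0 ρ =
      ENNReal.ofReal (meanForm t m0 K zt ((x0, ∫ y, y ∂θ), (u0, meanAction θ ρ))) +
        ∫⁻ m1, ∫⁻ x, ENNReal.ofReal (devForm t m0 K m1 (deviation θ ρ m1 x)) ∂θ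
          ∂S.modeBelief zt + noiseCost t m0 K zt := by
  have := hθ.1
  set y := predictMean m0 zt ((x0, ∫ y, y ∂θ), (u0, meanAction θ ρ)) with hy
  rw [stageValue_eq_lintegral_stageForm hV hθ hρ hρ2 (integral_nextState1 hθ.2 hρ hρ2), ← hy,
    lintegral_plantLaw (f := fun b => ENNReal.ofReal
      (stageForm t m0 K b.1.2 (stageVec x0 u0 ρ b.1, b.2, y))) (measurable_stageForm_stageVec hρ y)]
  simp only [lintegral_stageForm_noise _ (stageVec x0 u0 ρ _)]
  have hmode : ∀ᵐ m1 ∂S.modeBelief zt,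
      ∫⁻ x, (ENNReal.ofReal (stageForm t m0 K m1 (stageVec x0 u0 ρ (x, m1), 0, y)) +
        ∫⁻ w, ENNReal.ofReal (stageForm t m0 K m1 (0, w, 0)) ∂(S.πW0 t).prod (S.πW1 t)) ∂θ =
      ENNReal.ofReal (stageForm t m0 K m1
          (meanStage m1 ((x0, ∫ y, y ∂θ), (u0, meanAction θ ρ)), 0, y)) +
        ∫⁻ x, ENNReal.ofReal (devForm t m0 K m1 (deviation θ ρ m1 x)) ∂θ +
        ∫⁻ w, ENNReal.ofReal (stageForm t m0 K m1 (0, w, 0)) ∂(S.πW0 t).prod (S.πW1 t) := by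
    filter_upwards [ae_memLp_section hρ hρ2] with m1 hm1
    rw [lintegral_add_right _ measurable_const, lintegral_stageForm_stageVec hθ.2 hm1]
    simp
  rw [lintegral_congr_ae hmode, lintegral_add_right _ .of_discrete,
    lintegral_add_right _ .of_discrete, ofReal_meanForm, noiseCost]
  simp only [add_assoc, ← hy]

end BiasVariance

end System

namespace System

variable {S : System}

section Prescription

variable {θ : Measure (Vec S.dX1)} {qb : Fin S.κ1 → Vec S.dU1} {qt : S.Presc}

theorem measurable_combine (hqt : qt ∈ S.QTilde θ) : Measurable (S.combine qb qt) :=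
  (Measurable.of_discrete.comp measurable_snd).add hqt.1

theorem meanAction_combine [IsProbabilityMeasure θ] (hqt : qt ∈ S.QTilde θ) :
    meanAction θ (S.combine qb qt) = qb := by
  funext m1
  obtain ⟨hint, hzero⟩ := hqt.2 m1
  calc meanAction θ (S.combine qb qt) m1 = ∫ x, (qb m1 + qt (x, m1)) ∂θ := rfl
    _ = qb m1 := by rw [integral_add (integrable_const _) hint, hzero]; simp

end Prescription

section Gains

variable (S) in
/-- Coefficients of prescriptions that are linear in the means and in the deviation of `X¹_t` from
its mean. -/
structure Gains where
  mean : Fin S.κ0 → Option (Fin S.κ1) →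
    (Vec S.dX0 × Vec S.dX1) →ₗ[ℝ] Vec S.dU0 × (Fin S.κ1 → Vec S.dU1)
  dev : Fin S.κ0 → Fin S.κ1 → Vec S.dX1 →ₗ[ℝ] Vec S.dU1

variable (G : S.Gains) (t : ℕ) (K : S.QuadraticValue) (x0 : Vec S.dX0) (m0 : Fin S.κ0)
  (θ : Measure (Vec S.dX1)) (zt : Option (Fin S.κ1))

/-- The action `u⁰` selected by the gains. -/
def Gains.act : Vec S.dU0 := (G.mean m0 zt (x0, ∫ y, y ∂θ)).1

/-- The part `q̄` of the prescription selected by the gains. -/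
def Gains.qBar : Fin S.κ1 → Vec S.dU1 := (G.mean m0 zt (x0, ∫ y, y ∂θ)).2

/-- The part `q̃` of the prescription selected by the gains. -/
def Gains.qTilde : S.Presc := fun a => G.dev m0 a.2 (a.1 - ∫ y, y ∂θ)

/-- The gains minimize the mean part and the deviation part of the stage value with the cost to go
`K`. -/
structure Gains.IsMinimizing : Prop where
  mean_le : ∀ m0 zt x u, meanForm t m0 K zt (x, G.mean m0 zt x) ≤ meanForm t m0 K zt (x, u)
  dev_le : ∀ m0 m1 x u, devForm t m0 K m1 (x, G.dev m0 m1 x) ≤ devForm t m0 K m1 (x, u)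

/-- The Riccati recursion: the coefficients of the stage value under the prescriptions selected by
the gains `G`, with the cost to go `K`. -/
def riccati [Fact (t ≤ S.T)] : S.QuadraticValue where
  mean m0 zt := (meanForm t m0 K zt).comp (LinearMap.id.prod (G.mean m0 zt))
  cov m0 zt := averageForm (S.modeBelief zt) fun m1 =>
    (devForm t m0 K m1).comp (LinearMap.id.prod (G.dev m0 m1))
  const m0 zt := noiseCost t m0 K zt
  mean_nonneg _ _ _ := meanForm_nonneg _
  cov_nonneg m0 _ x := averageForm_nonneg
    (Q := fun m1 => (devForm t m0 K m1).comp (LinearMap.id.prod (G.dev m0 m1)))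
    (fun _ _ => devForm_nonneg _) x

variable {G t K x0 m0 θ zt}

theorem Gains.measurable_qTilde : Measurable (G.qTilde m0 θ) :=
  measurable_linearMap_apply (G.dev m0) measurable_snd (by fun_prop)

theorem Gains.qTilde_mem [IsProbabilityMeasure θ] (hθ : MemLp id 2 θ) :
    G.qTilde m0 θ ∈ S.QTilde θ := by
  refine ⟨measurable_qTilde, fun m1 => ?_⟩
  let D := (G.dev m0 m1).toContinuousLinearMap
  have hid : Integrable (fun x => x) θ := hθ.integrable one_le_two
  have hsub : Integrable (fun x => x - ∫ y, y ∂θ) θ := hid.sub (integrable_const _)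
  refine ⟨D.integrable_comp hsub, (D.integral_comp_comm hsub).trans ?_⟩
  rw [integral_sub hid (integrable_const _)]
  simp

theorem Gains.memLp_combine [IsProbabilityMeasure θ] (hθ : MemLp id 2 θ) :
    MemLp (S.combine (G.qBar x0 m0 θ zt) (G.qTilde m0 θ)) 2 (θ.prod (S.modeBelief zt)) := by
  let D (m1 : Fin S.κ1) := (G.dev m0 m1).toContinuousLinearMap
  have hqb : MemLp (G.qBar x0 m0 θ zt) 2 (S.modeBelief zt) :=
    MemLp.of_discrete
  have hsub : MemLp (fun a : Vec S.dX1 × Fin S.κ1 => a.1 - ∫ y, y ∂θ) 2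
      (θ.prod (S.modeBelief zt)) :=
    (hθ.comp_measurePreserving measurePreserving_fst).sub (memLp_const _)
  refine (hqb.comp_measurePreserving measurePreserving_snd).add
    (hsub.of_le_mul (c := ∑ m1, ‖D m1‖) measurable_qTilde.aestronglyMeasurable
      (ae_of_all _ fun a => ?_))
  exact ((D a.2).le_opNorm _).trans (mul_le_mul_of_nonneg_right
    (Finset.single_le_sum (f := fun m1 => ‖D m1‖) (fun _ _ => norm_nonneg _)
      (Finset.mem_univ a.2)) (norm_nonneg _))

variable [ht : Fact (t ≤ S.T)]

theorem exists_isMinimizing (K : S.QuadraticValue) : ∃ G : S.Gains, G.IsMinimizing t K := by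
  have hmean (m0 : Fin S.κ0) (zt : Option (Fin S.κ1)) := exists_linearMap_minimizer
    (meanForm_nonneg (t := t) (m0 := m0) (K := K) (zt := zt))
  have hdev (m0 : Fin S.κ0) (m1 : Fin S.κ1) := exists_linearMap_minimizer
    (devForm_nonneg (t := t) (m0 := m0) (K := K) (m1 := m1))
  choose L hL using hmean
  choose D hD using hdev
  exact ⟨⟨L, D⟩, hL, hD⟩

theorem lintegral_riccati_cov [IsProbabilityMeasure θ] :
    ∫⁻ x, ENNReal.ofReal ((riccati G t K).cov m0 zt (x - ∫ y, y ∂θ)) ∂θ =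
      ∫⁻ m1, ∫⁻ x, ENNReal.ofReal
        (devForm t m0 K m1 (x - ∫ y, y ∂θ, G.dev m0 m1 (x - ∫ y, y ∂θ))) ∂θ
        ∂S.modeBelief zt := by
  have hmeas : Measurable fun b : Vec S.dX1 × Fin S.κ1 => ENNReal.ofReal
      ((devForm t m0 K b.2).comp (LinearMap.id.prod (G.dev m0 b.2)) (b.1 - ∫ y, y ∂θ)) :=
    (measurable_quadraticForm_apply
      (fun m1 => (devForm t m0 K m1).comp (LinearMap.id.prod (G.dev m0 m1))) measurable_snd
      (by fun_prop)).ennreal_ofReal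
  have hdev (x : Vec S.dX1) := ofReal_averageForm (μ := S.modeBelief zt)
    (Q := fun m1 => (devForm t m0 K m1).comp (LinearMap.id.prod (G.dev m0 m1)))
    (fun _ _ => devForm_nonneg _) x
  simp only [riccati, hdev]
  exact lintegral_lintegral_swap hmeas.aemeasurable

variable {V : S.ValueFn} {u0 : Vec S.dU0} {ρ : S.Presc}

theorem stageValue_gains (hV : V.HasCoeffs K) (hθ : IsBelief θ) :
    S.stageValue t V x0 m0 θ zt (G.act x0 m0 θ zt)
        (S.combine (G.qBar x0 m0 θ zt) (G.qTilde m0 θ)) =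
      (riccati G t K).eval x0 m0 θ zt := by
  have := hθ.1
  have hqt := G.qTilde_mem (m0 := m0) hθ.2
  have hdev (m1 : Fin S.κ1) (x : Vec S.dX1) :
      deviation θ (S.combine (G.qBar x0 m0 θ zt) (G.qTilde m0 θ)) m1 x =
        (x - ∫ y, y ∂θ, G.dev m0 m1 (x - ∫ y, y ∂θ)) := by
    rw [deviation, meanAction_combine hqt]
    simp [combine, Gains.qTilde]
  rw [stageValue_eq_meanForm_add hV hθ (measurable_combine hqt) (G.memLp_combine hθ.2),
    meanAction_combine hqt, QuadraticValue.eval, lintegral_riccati_cov]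
  simp only [hdev]
  rfl

theorem riccati_eval_le_stageValue (hG : G.IsMinimizing t K) (hV : V.HasCoeffs K)
    (hθ : IsBelief θ) (hρ : Measurable ρ) :
    (riccati G t K).eval x0 m0 θ zt ≤ S.stageValue t V x0 m0 θ zt u0 ρ := by
  have := hθ.1
  by_cases hcost : S.stageCost t x0 m0 θ zt u0 ρ = ∞
  · rw [stageValue_eq_add hV hρ, hcost, top_add]
    exact le_top
  rw [stageValue_eq_meanForm_add hV hθ hρ (memLp_presc_of_stageCost_ne_top hρ hcost),
    QuadraticValue.eval, lintegral_riccati_cov]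
  gcongr with m1 x
  · exact hG.mean_le m0 zt _ _
  · exact hG.dev_le m0 m1 _ _
  · exact le_rfl

end Gains

theorem ValueFn.ext_eq_of_coe_eq (V : S.ValueFn) {x0 : Vec S.dX0} {m0 : Fin S.κ0}
    {θ : Belief S.dX1} {zt : Option (Fin S.κ1)} {a : ℝ≥0∞}
    (h : ((V x0 m0 θ zt : ℝ) : EReal) = a) : V.ext x0 m0 θ.1 zt = a := by
  rw [V.ext_of_isBelief _ _ θ.2, ← EReal.toENNReal_coe (x := a), ← h, EReal.toENNReal,
    if_neg (EReal.coe_ne_top _), EReal.toReal_coe]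

namespace SolvesDP

variable {V : ℕ → S.ValueFn} {K : S.QuadraticValue} {t : ℕ} [ht : Fact (t ≤ S.T)]

theorem hasCoeffs_riccati (hV : S.SolvesDP V) (hK : (V (t + 1)).HasCoeffs K) {G : S.Gains}
    (hG : G.IsMinimizing t K) : (V t).HasCoeffs (riccati G t K) := by
  intro x0 m0 θ zt
  have := θ.2.1
  obtain ⟨⟨u0, qb, -, qt, hqt, hattain⟩, hle⟩ := hV.step t ht.out x0 m0 θ zt
  have hgains := hle ⟨G.act x0 m0 θ.1 zt, G.qBar x0 m0 θ.1 zt, Measurable.of_discrete,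
    G.qTilde m0 θ.1, G.qTilde_mem (θ := θ.1) θ.2.2, rfl⟩
  rw [stageValue_gains hK θ.2] at hgains
  have hvalue : ((V t x0 m0 θ zt : ℝ) : EReal) = (riccati G t K).eval x0 m0 θ.1 zt :=
    hgains.antisymm (hattain ▸ EReal.coe_ennreal_le_coe_ennreal_iff.2
      (riccati_eval_le_stageValue hG hK θ.2 (measurable_combine hqt)))
  exact (V t).ext_eq_of_coe_eq hvalue

omit ht in
theorem exists_hasCoeffs (hV : S.SolvesDP V) (hle : t ≤ S.T + 1) : ∃ K, (V t).HasCoeffs K := by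
  induction hle using Nat.decreasingInduction with
  | self => exact ValueFn.exists_hasCoeffs_of_eq_zero hV.terminal
  | of_succ s hs ih =>
    have : Fact (s ≤ S.T) := ⟨Nat.lt_succ_iff.1 hs⟩
    obtain ⟨K, hK⟩ := ih
    obtain ⟨G, hG⟩ := exists_isMinimizing (t := s) K
    exact ⟨_, hV.hasCoeffs_riccati hK hG⟩

theorem ext_le_stageValue (hV : S.SolvesDP V) {x0 : Vec S.dX0} {m0 : Fin S.κ0}
    {θ : Measure (Vec S.dX1)} (hθ : IsBelief θ) {zt : Option (Fin S.κ1)} {u0 : Vec S.dU0}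
    {ρ : S.Presc} (hρ : Measurable ρ) :
    (V t).ext x0 m0 θ zt ≤ S.stageValue t (V (t + 1)) x0 m0 θ zt u0 ρ := by
  obtain ⟨K, hK⟩ := hV.exists_hasCoeffs (Nat.succ_le_succ ht.out)
  obtain ⟨G, hG⟩ := exists_isMinimizing (t := t) K
  rw [hV.hasCoeffs_riccati hK hG x0 m0 ⟨θ, hθ⟩ zt]
  exact riccati_eval_le_stageValue hG hK hθ hρ

end SolvesDP

end System

section CondDistrib

variable {A B X Y Ω : Type*} [MeasurableSpace A] [MeasurableSpace B] [MeasurableSpace X]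
  [MeasurableSpace Y] [MeasurableSpace Ω] {P : Measure Ω} [IsProbabilityMeasure P]
  {C : Ω → A} {U : Ω → X} {N : Ω → B} {κ : Kernel A X} [IsMarkovKernel κ] {ν : Measure B}
  [IsProbabilityMeasure ν]

theorem hasCondDistrib_const_of_indepFun (hC : Measurable C) (hN : HasLaw N ν P)
    (h : IndepFun C N P) : HasCondDistrib N C (Kernel.const A ν) P := by
  refine ⟨hC.aemeasurable.prodMk hN.aemeasurable, ?_⟩
  rw [(indepFun_iff_map_prod_eq_prod_map_map hC.aemeasurable hN.aemeasurable).1 h, hN.map_eq,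
    Measure.compProd_const]

variable (hU : Measurable U) (hC : Measurable C) (hN : Measurable N)

include hU hC hN in
theorem hasCondDistrib_prodMk_of_indepFun (h : HasCondDistrib U C κ P) (hν : HasLaw N ν P)
    (hindep : IndepFun (fun ω => (C ω, U ω)) N P) :
    HasCondDistrib (fun ω => (U ω, N ω)) C (κ ×ₖ Kernel.const A ν) P := by
  refine hasCondDistrib_of_lintegral (hU.prodMk hN) hC fun f hf => ?_
  have hfN : Measurable fun a : (A × X) × B => f (a.1.1, a.1.2, a.2) := by fun_prop
  calc ∫⁻ ω, f (C ω, U ω, N ω) ∂P = ∫⁻ ω, ∫⁻ n, f (C ω, U ω, n) ∂ν ∂P :=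
        lintegral_comp_of_hasCondDistrib
          (hasCondDistrib_const_of_indepFun (hC.prodMk hU) hν hindep) hfN
    _ = ∫⁻ ω, ∫⁻ x, ∫⁻ n, f (C ω, x, n) ∂ν ∂κ (C ω) ∂P :=
        lintegral_comp_of_hasCondDistrib h (f := fun a => ∫⁻ n, f (a.1, a.2, n) ∂ν)
          hfN.lintegral_prod_right'
    _ = ∫⁻ ω, ∫⁻ y, f (C ω, y) ∂(κ ×ₖ Kernel.const A ν) (C ω) ∂P := by
        refine lintegral_congr fun ω => ?_
        rw [Kernel.prod_apply, Kernel.const_apply, lintegral_prod _ (by fun_prop)]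

include hU hC hN in
theorem hasCondDistrib_prodMkRight_of_indepFun (h : HasCondDistrib U C κ P) (hν : HasLaw N ν P)
    (hindep : IndepFun (fun ω => (C ω, U ω)) N P) :
    HasCondDistrib U (fun ω => (C ω, N ω)) (κ.prodMkRight B) P := by
  refine hasCondDistrib_of_lintegral hU (hC.prodMk hN) fun f hf => ?_
  have hCN : IndepFun C N P := hindep.comp measurable_fst measurable_id
  have hswap : Measurable fun a : A × X × B => f ((a.1, a.2.2), a.2.1) := by fun_prop
  have hint : Measurable fun a : A × B => ∫⁻ x, f (a, x) ∂κ a.1 :=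
    hf.lintegral_kernel_prod_right' (κ := κ.prodMkRight B)
  calc ∫⁻ ω, f ((C ω, N ω), U ω) ∂P
      = ∫⁻ ω, ∫⁻ y, f ((C ω, y.2), y.1) ∂(κ ×ₖ Kernel.const A ν) (C ω) ∂P :=
        lintegral_comp_of_hasCondDistrib
          (hasCondDistrib_prodMk_of_indepFun hU hC hN h hν hindep) hswap
    _ = ∫⁻ ω, ∫⁻ n, ∫⁻ x, f ((C ω, n), x) ∂κ (C ω) ∂ν ∂P := by
        refine lintegral_congr fun ω => ?_
        rw [Kernel.prod_apply, Kernel.const_apply, lintegral_prod_symm _ (by fun_prop)]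
    _ = ∫⁻ ω, ∫⁻ x, f ((C ω, N ω), x) ∂κ (C ω) ∂P :=
        (lintegral_comp_of_hasCondDistrib (hasCondDistrib_const_of_indepFun hC hν hCN)
          hint).symm

include hU hC in
theorem hasCondDistrib_comp_prodMk (h : HasCondDistrib U C κ P) {f : A × X → Y}
    (hf : Measurable f) {η : Kernel A Y} [IsMarkovKernel η]
    (hη : ∀ a, η a = (κ a).map fun x => f (a, x)) :
    HasCondDistrib (fun ω => f (C ω, U ω)) C η P := by
  refine hasCondDistrib_of_lintegral (hf.comp (hC.prodMk hU)) hC fun F hF => ?_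
  have hFf : Measurable fun a : A × X => F (a.1, f a) := by fun_prop
  rw [lintegral_comp_of_hasCondDistrib h hFf]
  refine lintegral_congr fun ω => ?_
  rw [hη, lintegral_map (by fun_prop) (by fun_prop)]

end CondDistrib

namespace System

variable {S : System} {Ω : Type*} {t : ℕ}

/-- The position of a primitive random variable when they are listed in the order
`X⁰_0, X¹_0, M⁰_0, M¹_0, Γ_0, W⁰_0, W¹_0, M⁰_1, M¹_1, Γ_1, W⁰_1, …` in which they enter the loop. -/
def Src.rank {T : ℕ} : Src T → ℕ
  | .x0 => 0
  | .x1 => 1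
  | .m0 s => 5 * s + 2
  | .m1 s => 5 * s + 3
  | .link s => 5 * s + 4
  | .w0 s => 5 * s + 5
  | .w1 s => 5 * s + 6

namespace Sources

/-- The `σ`-algebra generated by the primitive random variables of rank less than `n`. -/
@[reducible]
def past (ξ : S.Sources Ω) (n : ℕ) : MeasurableSpace Ω :=
  ⨆ i ∈ {i : Src S.T | i.rank < n}, MeasurableSpace.comap (ξ.rv i) inferInstance

/-- The `σ`-algebra generated by the primitive random variables of rank at least `n`. -/
@[reducible]
def future (ξ : S.Sources Ω) (n : ℕ) : MeasurableSpace Ω :=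
  ⨆ i ∈ {i : Src S.T | n ≤ i.rank}, MeasurableSpace.comap (ξ.rv i) inferInstance

variable {ξ : S.Sources Ω} {i : Src S.T} {n : ℕ}

theorem measurable_rv_past (hi : i.rank < n) : Measurable[ξ.past n] (ξ.rv i) :=
  Measurable.of_comap_le (le_iSup₂_of_le i hi le_rfl)

theorem measurable_rv_future (hi : n ≤ i.rank) : Measurable[ξ.future n] (ξ.rv i) :=
  Measurable.of_comap_le (le_iSup₂_of_le i hi le_rfl)

variable [MeasurableSpace Ω] {P : Measure Ω} {A B : Type*} [MeasurableSpace A]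
  [MeasurableSpace B] {f : Ω → A} {g : Ω → B}

theorem Admissible.hasLaw_rv (hξ : ξ.Admissible P) (i : Src S.T) :
    HasLaw (ξ.rv i) (S.srcLaw i) P :=
  ⟨(hξ.measurable i).aemeasurable, hξ.law i⟩

theorem Admissible.indepFun_of_rank (hξ : ξ.Admissible P) (n : ℕ)
    (hf : Measurable[ξ.past n] f) (hg : Measurable[ξ.future n] g) : IndepFun f g P := by
  have hdisj : Disjoint {i : Src S.T | i.rank < n} {i | n ≤ i.rank} :=
    Set.disjoint_left.2 fun _ hi hi' => (Nat.lt_of_lt_of_le hi hi').false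
  have h := indep_iSup_of_disjoint (fun i => (hξ.measurable i).comap_le) hξ.indep hdisj
  exact indep_of_indep_of_le_left (indep_of_indep_of_le_right h hg.comap_le) hf.comap_le

end Sources

section Strategy

/-- The measurability part of feasibility. -/
structure Strategy.IsMeasurable (φ : S.Strategy) : Prop where
  act : ∀ t ≤ S.T, Measurable (φ.act t)
  presc : ∀ t ≤ S.T, Measurable fun a : S.Hist t × (Vec S.dX1 × Fin S.κ1) => φ.presc t a.1 a.2

theorem Feasible.isMeasurable [MeasurableSpace Ω] {ξ : S.Sources Ω} {φ : S.Strategy}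
    {P : Measure Ω} (h : Feasible ξ φ P) : φ.IsMeasurable :=
  ⟨h.measurable_act, h.measurable_presc⟩

theorem Strategy.IsMeasurable.presc_apply {φ : S.Strategy} (hφ : φ.IsMeasurable) (ht : t ≤ S.T)
    (h : S.Hist t) : Measurable (φ.presc t h) :=
  (hφ.presc t ht).comp measurable_prodMk_left

end Strategy

section Hist

theorem measurable_last : Measurable (Hist.last : S.Hist t → S.Obs) := by
  cases t
  · exact measurable_id
  · exact measurable_snd.comp measurable_snd

theorem measurable_histX0 : Measurable (Hist.x0 : S.Hist t → Vec S.dX0) :=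
  measurable_fst.comp measurable_last

theorem measurable_histM0 : Measurable (Hist.m0 : S.Hist t → Fin S.κ0) :=
  (measurable_fst.comp measurable_snd).comp measurable_last

theorem measurable_zTilde : Measurable (Hist.zTilde : S.Hist t → Option (Fin S.κ1)) :=
  (measurable_snd.comp (measurable_snd.comp measurable_snd)).comp measurable_last

theorem measurable_next0 {A : Type*} [MeasurableSpace A] {x0 w : A → Vec S.dX0}
    {m0 : A → Fin S.κ0} {u0 : A → Vec S.dU0} (hx0 : Measurable x0) (hm0 : Measurable m0)
    (hu0 : Measurable u0) (hw : Measurable w) :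
    Measurable fun a => S.next0 (x0 a) (m0 a) (u0 a) (w a) :=
  (measurable_linearMap_apply S.drift0 hm0
    ((hx0.prodMk (measurable_const (a := (0 : Vec S.dX1)))).prodMk
      (hu0.prodMk (measurable_const (a := (0 : Vec S.dU1)))))).add hw

theorem measurable_next1 {A : Type*} [MeasurableSpace A] {x0 : A → Vec S.dX0}
    {x1 w : A → Vec S.dX1} {m0 : A → Fin S.κ0} {m1 : A → Fin S.κ1} {u0 : A → Vec S.dU0}
    {u1 : A → Vec S.dU1} (hx0 : Measurable x0) (hx1 : Measurable x1) (hm0 : Measurable m0)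
    (hm1 : Measurable m1) (hu0 : Measurable u0) (hu1 : Measurable u1) (hw : Measurable w) :
    Measurable fun a => S.next1 (x0 a) (x1 a) (m0 a) (m1 a) (u0 a) (u1 a) (w a) := by
  have h := (measurable_linearMap_apply (Function.uncurry S.drift1) (hm0.prodMk hm1)
    ((hx0.prodMk hx1).prodMk (hu0.prodMk hu1))).add hw
  exact (funext fun a => next1_eq (m0 a) (m1 a) ((x0 a, x1 a), (u0 a, u1 a)) (w a)) ▸ h

end Hist

section Loop

variable {ξ : S.Sources Ω} {φ : S.Strategy}

theorem commonInfo_m0 (ω : Ω) : (commonInfo ξ φ t ω).m0 = ξ.M0 t ω := by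
  cases t <;> rfl

theorem commonInfo_succ (ω : Ω) :
    commonInfo ξ φ (t + 1) ω =
      (commonInfo ξ φ t ω, action0 ξ φ t ω,
        S.next0 (state0 ξ φ t ω) (ξ.M0 t ω) (action0 ξ φ t ω) (ξ.W0 t ω), ξ.M0 (t + 1) ω,
        channel (ξ.link (t + 1) ω) (state1 ξ φ (t + 1) ω),
        channel (ξ.link (t + 1) ω) (ξ.M1 (t + 1) ω)) := rfl

theorem state1_succ (ω : Ω) :
    state1 ξ φ (t + 1) ω =
      S.next1 (state0 ξ φ t ω) (state1 ξ φ t ω) (ξ.M0 t ω) (ξ.M1 t ω) (action0 ξ φ t ω)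
        (action1 ξ φ t ω) (ξ.W1 t ω) := rfl

variable [MeasurableSpace Ω]

theorem measurable_commonInfo_and_state1 (hφ : φ.IsMeasurable) (ht : t ≤ S.T) :
    ((∀ i : Src S.T, i.rank < 5 * t + 5 → Measurable (ξ.rv i)) → Measurable (commonInfo ξ φ t)) ∧
      ((∀ i : Src S.T, i.rank < 5 * t + 2 → Measurable (ξ.rv i)) →
        Measurable (state1 ξ φ t)) := by
  induction t with
  | zero =>
    refine ⟨fun h => ?_, fun h => h .x1 Nat.one_lt_two⟩
    have hlink : Measurable (ξ.link 0) := h (.link 0) (by simp [Src.rank])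
    have hX0 : Measurable ξ.X0 := h .x0 (by simp [Src.rank])
    have hX1 : Measurable ξ.X1 := h .x1 (by simp [Src.rank])
    have hM0 : Measurable (ξ.M0 0) := h (.m0 0) (by simp [Src.rank])
    have hM1 : Measurable (ξ.M1 0) := h (.m1 0) (by simp [Src.rank])
    exact hX0.prodMk (hM0.prodMk
      ((measurable_channel hlink hX1).prodMk (measurable_channel hlink hM1)))
  | succ t ih =>
    have hstate (h : ∀ i : Src S.T, i.rank < 5 * (t + 1) + 2 → Measurable (ξ.rv i)) :
        Measurable (commonInfo ξ φ t) ∧ Measurable (state1 ξ φ (t + 1)) := by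
      have hH := (ih (Nat.le_of_succ_le ht)).1 fun i hi => h i (by omega)
      have hX1 := (ih (Nat.le_of_succ_le ht)).2 fun i hi => h i (by omega)
      have hM0 : Measurable (ξ.M0 t) := h (.m0 ⟨t, by omega⟩) (by simp only [Src.rank]; omega)
      have hM1 : Measurable (ξ.M1 t) := h (.m1 ⟨t, by omega⟩) (by simp only [Src.rank]; omega)
      have hW1 : Measurable (ξ.W1 t) := h (.w1 ⟨t, by omega⟩) (by simp only [Src.rank]; omega)
      exact ⟨hH, measurable_next1 (measurable_histX0.comp hH) hX1 hM0 hM1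
        ((hφ.act t (by omega)).comp hH)
        ((hφ.presc t (by omega)).comp (hH.prodMk (hX1.prodMk hM1))) hW1⟩
    refine ⟨fun h => ?_, fun h => (hstate h).2⟩
    obtain ⟨hH, hX1'⟩ := hstate fun i hi => h i (by omega)
    have hM0 : Measurable (ξ.M0 t) := h (.m0 ⟨t, by omega⟩) (by simp only [Src.rank]; omega)
    have hW0 : Measurable (ξ.W0 t) := h (.w0 ⟨t, by omega⟩) (by simp only [Src.rank]; omega)
    have hM0' : Measurable (ξ.M0 (t + 1)) :=
      h (.m0 ⟨t + 1, by omega⟩) (by simp only [Src.rank]; omega)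
    have hM1' : Measurable (ξ.M1 (t + 1)) :=
      h (.m1 ⟨t + 1, by omega⟩) (by simp only [Src.rank]; omega)
    have hlink' : Measurable (ξ.link (t + 1)) :=
      h (.link ⟨t + 1, by omega⟩) (by simp only [Src.rank]; omega)
    have hU0 := (hφ.act t (by omega)).comp hH
    exact hH.prodMk (hU0.prodMk ((measurable_next0 (measurable_histX0.comp hH) hM0 hU0 hW0).prodMk
      (hM0'.prodMk ((measurable_channel hlink' hX1').prodMk (measurable_channel hlink' hM1')))))

end Loop

section Measurability

variable {ξ : S.Sources Ω} {φ : S.Strategy}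

theorem Sources.past_mono : Monotone ξ.past := fun _ _ hmn =>
  biSup_mono fun _ hi => Nat.lt_of_lt_of_le hi hmn

theorem measurable_past_commonInfo (hφ : φ.IsMeasurable) (ht : t ≤ S.T) :
    Measurable[ξ.past (5 * t + 5)] (commonInfo ξ φ t) :=
  letI := ξ.past (5 * t + 5)
  (measurable_commonInfo_and_state1 hφ ht).1 fun _ hi => Sources.measurable_rv_past hi

theorem measurable_past_state1 (hφ : φ.IsMeasurable) (ht : t ≤ S.T) :
    Measurable[ξ.past (5 * t + 2)] (state1 ξ φ t) :=
  letI := ξ.past (5 * t + 2)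
  (measurable_commonInfo_and_state1 hφ ht).2 fun _ hi => Sources.measurable_rv_past hi

variable [MeasurableSpace Ω] {P : Measure Ω}

theorem Sources.Admissible.past_le (hξ : ξ.Admissible P) (n : ℕ) :
    ξ.past n ≤ ‹MeasurableSpace Ω› :=
  iSup₂_le fun i _ => (hξ.measurable i).comap_le

theorem Sources.Admissible.measurable_commonInfo (hξ : ξ.Admissible P) (hφ : φ.IsMeasurable)
    (ht : t ≤ S.T) : Measurable (commonInfo ξ φ t) :=
  (measurable_commonInfo_and_state1 hφ ht).1 fun i _ => hξ.measurable i

theorem Sources.Admissible.measurable_state1 (hξ : ξ.Admissible P) (hφ : φ.IsMeasurable)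
    (ht : t ≤ S.T) : Measurable (state1 ξ φ t) :=
  (measurable_commonInfo_and_state1 hφ ht).2 fun i _ => hξ.measurable i

end Measurability

section Extension

variable [MeasurableSpace Ω] {P : Measure Ω} [IsProbabilityMeasure P] {ξ : S.Sources Ω}
  {A X : Type*} [MeasurableSpace A] [MeasurableSpace X] {C : Ω → A} {U : Ω → X}
  {κ : Kernel A X} [IsMarkovKernel κ]

instance (i : Src S.T) : IsProbabilityMeasure (S.srcLaw i) := by
  cases i with
  | x0 => exact S.isBelief_πX0.1
  | x1 => exact S.isBelief_πX1.1
  | w0 s => exact (S.isBelief_πW0 s s.is_le).1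
  | w1 s => exact (S.isBelief_πW1 s s.is_le).1
  | m0 => exact S.isProb_πM0
  | m1 => exact S.isProb_πM1
  | link => exact S.isProb_p

theorem Sources.Admissible.hasCondDistrib_prodMk_rv (hξ : ξ.Admissible P) (i : Src S.T)
    (hC : Measurable[ξ.past i.rank] C) (hU : Measurable[ξ.past i.rank] U)
    (h : HasCondDistrib U C κ P) :
    HasCondDistrib (fun ω => (U ω, ξ.rv i ω)) C (κ ×ₖ Kernel.const A (S.srcLaw i)) P :=
  hasCondDistrib_prodMk_of_indepFun (hU.mono (hξ.past_le _) le_rfl) (hC.mono (hξ.past_le _) le_rfl)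
    (hξ.measurable i) h (hξ.hasLaw_rv i)
    (hξ.indepFun_of_rank i.rank (hC.prodMk hU) (Sources.measurable_rv_future le_rfl))

theorem Sources.Admissible.hasCondDistrib_prodMkRight_rv (hξ : ξ.Admissible P) (i : Src S.T)
    (hC : Measurable[ξ.past i.rank] C) (hU : Measurable[ξ.past i.rank] U)
    (h : HasCondDistrib U C κ P) :
    HasCondDistrib U (fun ω => (C ω, ξ.rv i ω)) (κ.prodMkRight (S.SrcVal i)) P :=
  hasCondDistrib_prodMkRight_of_indepFun (hU.mono (hξ.past_le _) le_rfl)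
    (hC.mono (hξ.past_le _) le_rfl) (hξ.measurable i) h (hξ.hasLaw_rv i)
    (hξ.indepFun_of_rank i.rank (hC.prodMk hU) (Sources.measurable_rv_future le_rfl))

end Extension

end System

section ErasureKernel

variable {A Y : Type*} [MeasurableSpace A] [MeasurableSpace Y]

/-- The conditional distribution of a signal of prior law `κ a` given the output of an erasure
channel. -/
def erasureKernel (κ : Kernel A Y) : Kernel (A × Option Y) Y where
  toFun a := a.2.elim (κ a.1) Measure.dirac
  measurable' := measurable_prod_option κ.measurable (Measure.measurable_dirac.comp measurable_snd)

instance (κ : Kernel A Y) [IsMarkovKernel κ] : IsMarkovKernel (erasureKernel κ) :=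
  ⟨fun ⟨a, z⟩ => by
    cases z
    · exact inferInstanceAs (IsProbabilityMeasure (κ a))
    · exact Measure.dirac.isProbabilityMeasure⟩

variable {X Ω : Type*} [MeasurableSpace X] [StandardBorelSpace X] [Nonempty X] [MeasurableSpace Ω]
  {P : Measure Ω} [IsProbabilityMeasure P] {U : Ω → X} {N : Ω → Y} {C : Ω → A} {κ : Kernel A X}
  {η : Kernel A Y} [IsMarkovKernel κ] [IsMarkovKernel η]

theorem condDistrib_ae_eq_of_hasCondDistrib_prod
    (h : HasCondDistrib (fun ω => (U ω, N ω)) C (κ ×ₖ η) P) : condDistrib U C P =ᵐ[P.map C] κ := by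
  have hU := h.fst
  rw [Kernel.fst_prod] at hU
  exact condDistrib_ae_eq_of_measure_eq_compProd C hU.aemeasurable_snd hU.map_eq

theorem hasCondDistrib_condDistrib_prod
    (h : HasCondDistrib (fun ω => (U ω, N ω)) C (κ ×ₖ η) P) :
    HasCondDistrib (fun ω => (U ω, N ω)) C (condDistrib U C P ×ₖ η) P := by
  refine ⟨h.aemeasurable, h.map_eq.trans (Measure.compProd_congr ?_)⟩
  filter_upwards [condDistrib_ae_eq_of_hasCondDistrib_prod h] with a ha
  rw [Kernel.prod_apply, Kernel.prod_apply, ha]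

end ErasureKernel

namespace System

variable {S : System} {t : ℕ} {φ : S.Strategy}

section Kernels

/-- The conditional distribution of `M¹_t` given `H⁰_t`. -/
def modeKernel (t : ℕ) : Kernel (S.Hist t) (Fin S.κ1) where
  toFun h := S.modeBelief h.zTilde
  measurable' := (measurable_of_countable S.modeBelief).comp measurable_zTilde

instance : IsMarkovKernel (modeKernel t : Kernel (S.Hist t) _) :=
  ⟨fun h => inferInstanceAs (IsProbabilityMeasure (S.modeBelief h.zTilde))⟩

/-- `X¹_{t+1}` as a function of `(h⁰_t, ((x¹_t, m¹_t), w¹_t))` when `φ` is used. -/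
def localStep (φ : S.Strategy) (t : ℕ)
    (a : S.Hist t × (Vec S.dX1 × Fin S.κ1) × Vec S.dX1) : Vec S.dX1 :=
  S.next1 a.1.x0 a.2.1.1 a.1.m0 a.2.1.2 (φ.act t a.1) (φ.presc t a.1 a.2.1) a.2.2

theorem measurable_localStep (hφ : φ.IsMeasurable) (ht : t ≤ S.T) :
    Measurable (localStep φ t) :=
  measurable_next1 (measurable_histX0.comp measurable_fst)
    (measurable_fst.comp (measurable_fst.comp measurable_snd))
    (measurable_histM0.comp measurable_fst)
    (measurable_snd.comp (measurable_fst.comp measurable_snd))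
    ((hφ.act t ht).comp measurable_fst)
    ((hφ.presc t ht).comp (measurable_fst.prodMk (measurable_fst.comp measurable_snd)))
    (measurable_snd.comp measurable_snd)

theorem beliefUpdate_none_eq_map_localStep (hφ : φ.IsMeasurable) (ht : t ≤ S.T)
    (θ : Measure (Vec S.dX1)) [SFinite θ] (h : S.Hist t) :
    S.beliefUpdate t θ (φ.act t h) (φ.presc t h) h.x0 h.m0 h.zTilde none =
      ((θ.prod (S.modeBelief h.zTilde)).prod (S.πW1 t)).map fun b => localStep φ t (h, b) := by
  have : Fact (t ≤ S.T) := ⟨ht⟩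
  have hstep : Measurable fun b => localStep φ t (h, b) :=
    (measurable_localStep hφ ht).comp measurable_prodMk_left
  have hassoc : (θ.prod ((S.modeBelief h.zTilde).prod (S.πW1 t))).map
      MeasurableEquiv.prodAssoc.symm = (θ.prod (S.modeBelief h.zTilde)).prod (S.πW1 t) := by
    rw [← Measure.prodAssoc_prod, MeasurableEquiv.map_symm_map]
  rw [← hassoc, Measure.map_map hstep MeasurableEquiv.prodAssoc.symm.measurable]
  rfl

/-- The conditional distribution of `X¹_{t+1}` given `H⁰_t`, when that of `X¹_t` is `κ`. -/
def predictKernel (hφ : φ.IsMeasurable) (ht : t ≤ S.T) (κ : Kernel (S.Hist t) (Vec S.dX1))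
    [IsMarkovKernel κ] : Kernel (S.Hist t) (Vec S.dX1) where
  toFun h := S.beliefUpdate t (κ h) (φ.act t h) (φ.presc t h) h.x0 h.m0 h.zTilde none
  measurable' := by
    have : Fact (t ≤ S.T) := ⟨ht⟩
    convert measurable_map_kernel ((κ ×ₖ modeKernel t) ×ₖ Kernel.const (S.Hist t) (S.πW1 t))
      (measurable_localStep hφ ht) with h
    rw [beliefUpdate_none_eq_map_localStep hφ ht, Kernel.prod_apply, Kernel.prod_apply]
    rfl

instance (hφ : φ.IsMeasurable) (ht : t ≤ S.T) (κ : Kernel (S.Hist t) (Vec S.dX1))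
    [IsMarkovKernel κ] : IsMarkovKernel (predictKernel hφ ht κ) :=
  ⟨fun h =>
    have : Fact (t ≤ S.T) := ⟨ht⟩
    isProbabilityMeasure_beliefUpdate (hφ.presc_apply ht h) none⟩

/-- The channel output `z_t`. -/
def Hist.z (h : S.Hist t) : Option (Vec S.dX1) := h.last.2.2.1

theorem measurable_histZ : Measurable (Hist.z : S.Hist t → _) :=
  (measurable_fst.comp (measurable_snd.comp measurable_snd)).comp measurable_last

/-- The conditional distribution of `X¹_0` given `H⁰_0`. -/
def initKernel : Kernel (S.Hist 0) (Vec S.dX1) :=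
  (erasureKernel (Kernel.const (S.Hist 0) S.πX1)).comap (fun h => (h, h.z))
    (measurable_id.prodMk measurable_histZ)

/-- The conditional distribution of `X¹_{t+1}` given `H⁰_{t+1}`, when that of `X¹_t` given `H⁰_t`
is `κ`. -/
def updateKernel (hφ : φ.IsMeasurable) (ht : t ≤ S.T) (κ : Kernel (S.Hist t) (Vec S.dX1))
    [IsMarkovKernel κ] : Kernel (S.Hist (t + 1)) (Vec S.dX1) :=
  (erasureKernel (predictKernel hφ ht κ)).comap (fun h : S.Hist (t + 1) => (h.1, h.z))
    (Measurable.prodMk measurable_fst measurable_histZ)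

instance : IsMarkovKernel (initKernel : Kernel (S.Hist 0) _) := by
  unfold initKernel
  infer_instance

instance (hφ : φ.IsMeasurable) (ht : t ≤ S.T) (κ : Kernel (S.Hist t) (Vec S.dX1))
    [IsMarkovKernel κ] : IsMarkovKernel (updateKernel hφ ht κ) := by
  unfold updateKernel
  infer_instance

theorem updateKernel_apply (hφ : φ.IsMeasurable) (ht : t ≤ S.T)
    (κ : Kernel (S.Hist t) (Vec S.dX1)) [IsMarkovKernel κ] (h : S.Hist (t + 1)) :
    updateKernel hφ ht κ h =
      S.beliefUpdate t (κ h.1) (φ.act t h.1) (φ.presc t h.1) (Hist.x0 h.1) (Hist.m0 h.1)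
        (Hist.zTilde h.1) h.z := by
  cases hz : h.z <;> simp only [updateKernel, Kernel.comap_apply, hz] <;> rfl

end Kernels

section Filter

variable {Ω A B : Type*} [MeasurableSpace Ω] [MeasurableSpace A] [MeasurableSpace B]
  {P : Measure Ω} [IsProbabilityMeasure P] {ξ : S.Sources Ω}

theorem hasCondDistrib_reception (hξ : ξ.Admissible P) (ht : t ≤ S.T) {C : Ω → A}
    {X : Ω → Vec S.dX1} (hC : Measurable[ξ.past (5 * t + 2)] C)
    (hX : Measurable[ξ.past (5 * t + 2)] X) {κ : Kernel A (Vec S.dX1)} [IsMarkovKernel κ]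
    (h : HasCondDistrib X C κ P)
    {e : A × Fin S.κ0 × Option (Vec S.dX1) × Option (Fin S.κ1) → B} (he : Measurable e)
    {η : Kernel B (Vec S.dX1 × Fin S.κ1)} [IsMarkovKernel η]
    (hη_none : ∀ a m0, η (e (a, m0, none, none)) = (κ a).prod S.πM1)
    (hη_some : ∀ a m0 x m, η (e (a, m0, some x, some m)) = Measure.dirac (x, m)) :
    HasCondDistrib (fun ω => (X ω, ξ.M1 t ω))
      (fun ω => e (C ω, ξ.M0 t ω, channel (ξ.link t ω) (X ω), channel (ξ.link t ω) (ξ.M1 t ω)))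
      η P := by
  let s : Fin (S.T + 1) := ⟨t, Nat.lt_succ_of_le ht⟩
  have hM0 : Measurable[ξ.past (5 * t + 3)] (ξ.M0 t) :=
    Sources.measurable_rv_past (i := .m0 s) (Nat.lt_succ_self _)
  have hM1 : Measurable[ξ.past (5 * t + 4)] (ξ.M1 t) :=
    Sources.measurable_rv_past (i := .m1 s) (Nat.lt_succ_self _)
  have hle : ξ.past (5 * t + 2) ≤ ξ.past (5 * t + 3) := Sources.past_mono (Nat.le_succ _)
  have hle' : ξ.past (5 * t + 3) ≤ ξ.past (5 * t + 4) := Sources.past_mono (Nat.le_succ _)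
  have hCM0 : Measurable[ξ.past (5 * t + 3)] fun ω => (C ω, ξ.M0 t ω) :=
    (hC.mono hle le_rfl).prodMk hM0
  have hXM1 : Measurable[ξ.past (5 * t + 4)] fun ω => (X ω, ξ.M1 t ω) :=
    (hX.mono (hle.trans hle') le_rfl).prodMk hM1
  have h₁ : HasCondDistrib X (fun ω => (C ω, ξ.M0 t ω)) (κ.prodMkRight (Fin S.κ0)) P :=
    hξ.hasCondDistrib_prodMkRight_rv (.m0 s) hC hX h
  have h₂ : HasCondDistrib (fun ω => (X ω, ξ.M1 t ω)) (fun ω => (C ω, ξ.M0 t ω))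
      (κ.prodMkRight (Fin S.κ0) ×ₖ Kernel.const _ S.πM1) P :=
    hξ.hasCondDistrib_prodMk_rv (.m1 s) hCM0 (hX.mono hle le_rfl) h₁
  have h₃ : HasCondDistrib (fun ω => ((X ω, ξ.M1 t ω), ξ.link t ω)) (fun ω => (C ω, ξ.M0 t ω))
      ((κ.prodMkRight (Fin S.κ0) ×ₖ Kernel.const _ S.πM1) ×ₖ Kernel.const _ S.p) P :=
    hξ.hasCondDistrib_prodMk_rv (.link s) (hCM0.mono hle' le_rfl) hXM1 h₂
  refine hasCondDistrib_of_erasure (hXM1.mono (hξ.past_le _) le_rfl)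
    (hCM0.mono (hξ.past_le _) le_rfl) (hξ.measurable (.link s)) h₃
    (g := fun a => e (a.1.1, a.1.2, channel a.2.2 a.2.1.1, channel a.2.2 a.2.1.2))
    (he.comp ?_) (fun _ _ _ => rfl) (fun a y => hη_some a.1 a.2 y.1 y.2) fun a y => ?_
  · exact (measurable_fst.comp measurable_fst).prodMk ((measurable_snd.comp measurable_fst).prodMk
      ((measurable_channel measurable_snd.snd measurable_snd.fst.fst).prodMk
        (measurable_channel measurable_snd.snd measurable_snd.fst.snd)))
  · rw [Kernel.prod_apply]
    exact hη_none a.1 a.2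

end Filter

end System

namespace System

variable {S : System} {t : ℕ} {φ : S.Strategy}

/-- `h⁰_{t+1}` as a function of `((h⁰_t, w⁰_t), (m⁰_{t+1}, z_{t+1}, z̃_{t+1}))` when `φ` is used. -/
def histStep (φ : S.Strategy) (t : ℕ)
    (a : (S.Hist t × Vec S.dX0) × Fin S.κ0 × Option (Vec S.dX1) × Option (Fin S.κ1)) :
    S.Hist (t + 1) :=
  (a.1.1, φ.act t a.1.1, S.next0 a.1.1.x0 a.1.1.m0 (φ.act t a.1.1) a.1.2, a.2)

theorem measurable_histStep (hφ : φ.IsMeasurable) (ht : t ≤ S.T) : Measurable (histStep φ t) := by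
  have hh : Measurable fun a : (S.Hist t × Vec S.dX0) × Fin S.κ0 × Option (Vec S.dX1) ×
      Option (Fin S.κ1) => a.1.1 := measurable_fst.comp measurable_fst
  have hu := (hφ.act t ht).comp hh
  exact hh.prodMk (hu.prodMk ((measurable_next0 (measurable_histX0.comp hh)
    (measurable_histM0.comp hh) hu (measurable_snd.comp measurable_fst)).prodMk measurable_snd))

theorem commonInfo_succ_eq_histStep {Ω : Type*} {ξ : S.Sources Ω} :
    commonInfo ξ φ (t + 1) = fun ω =>
      histStep φ t ((commonInfo ξ φ t ω, ξ.W0 t ω), ξ.M0 (t + 1) ω,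
        channel (ξ.link (t + 1) ω) (state1 ξ φ (t + 1) ω),
        channel (ξ.link (t + 1) ω) (ξ.M1 (t + 1) ω)) := by
  funext ω
  rw [commonInfo_succ, histStep, commonInfo_m0]
  rfl

section Invariant

variable {Ω : Type*} [MeasurableSpace Ω] {P : Measure Ω} [IsProbabilityMeasure P]
  {ξ : S.Sources Ω}

theorem hasCondDistrib_local_zero (hξ : ξ.Admissible P) :
    HasCondDistrib (fun ω => (state1 ξ φ 0 ω, ξ.M1 0 ω)) (commonInfo ξ φ 0)
      (initKernel ×ₖ modeKernel 0) P := by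
  have hX0 : Measurable[ξ.past 1] ξ.X0 := Sources.measurable_rv_past (i := .x0) Nat.one_pos
  have hX1 : Measurable[ξ.past 2] ξ.X1 := Sources.measurable_rv_past (i := .x1) Nat.one_lt_two
  have hindep : IndepFun ξ.X0 ξ.X1 P :=
    hξ.indepFun_of_rank 1 hX0 (Sources.measurable_rv_future (i := .x1) le_rfl)
  have hprior : HasCondDistrib ξ.X1 ξ.X0 (Kernel.const _ S.πX1) P :=
    hasCondDistrib_const_of_indepFun (hξ.measurable .x0) (hξ.hasLaw_rv .x1) hindep
  have hη_none (x0 : Vec S.dX0) (m0 : Fin S.κ0) :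
      (initKernel ×ₖ modeKernel 0 : Kernel (S.Hist 0) _) (x0, m0, none, none) =
        S.πX1.prod S.πM1 :=
    Kernel.prod_apply _ _ _
  have hη_some (x0 : Vec S.dX0) (m0 : Fin S.κ0) (x : Vec S.dX1) (m : Fin S.κ1) :
      (initKernel ×ₖ modeKernel 0 : Kernel (S.Hist 0) _) (x0, m0, some x, some m) =
        Measure.dirac (x, m) := by
    rw [← Measure.dirac_prod_dirac]
    exact Kernel.prod_apply _ _ _
  have he : @Measurable S.Obs (S.Hist 0) _ _ id := measurable_id
  exact hasCondDistrib_reception hξ (Nat.zero_le S.T)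
    (hX0.mono (Sources.past_mono one_le_two) le_rfl) hX1 hprior he hη_none hη_some

variable {κ : Kernel (S.Hist t) (Vec S.dX1)} [IsMarkovKernel κ]

theorem hasCondDistrib_state1_succ (hξ : ξ.Admissible P) (hφ : φ.IsMeasurable) (ht : t ≤ S.T)
    (h : HasCondDistrib (fun ω => (state1 ξ φ t ω, ξ.M1 t ω)) (commonInfo ξ φ t)
      (κ ×ₖ modeKernel t) P) :
    HasCondDistrib (state1 ξ φ (t + 1)) (fun ω => (commonInfo ξ φ t ω, ξ.W0 t ω))
      ((predictKernel hφ ht κ).prodMkRight (Vec S.dX0)) P := by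
  have : Fact (t ≤ S.T) := ⟨ht⟩
  let s : Fin (S.T + 1) := ⟨t, Nat.lt_succ_of_le ht⟩
  have hH := measurable_past_commonInfo (ξ := ξ) hφ ht
  have hXM : Measurable[ξ.past (5 * t + 5)] fun ω => (state1 ξ φ t ω, ξ.M1 t ω) :=
    ((measurable_past_state1 hφ ht).mono (Sources.past_mono (by omega)) le_rfl).prodMk
      (Sources.measurable_rv_past (i := .m1 s) (by simp only [Src.rank, s]; omega))
  have hle : ξ.past (5 * t + 5) ≤ ξ.past (5 * t + 6) := Sources.past_mono (Nat.le_succ _)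
  have hHW : Measurable[ξ.past (5 * t + 6)] fun ω => (commonInfo ξ φ t ω, ξ.W0 t ω) :=
    (hH.mono hle le_rfl).prodMk (Sources.measurable_rv_past (i := .w0 s) (Nat.lt_succ_self _))
  have h₁ : HasCondDistrib (fun ω => (state1 ξ φ t ω, ξ.M1 t ω))
      (fun ω => (commonInfo ξ φ t ω, ξ.W0 t ω)) ((κ ×ₖ modeKernel t).prodMkRight (Vec S.dX0)) P :=
    hξ.hasCondDistrib_prodMkRight_rv (.w0 s) hH hXM h
  have h₂ : HasCondDistrib (fun ω => ((state1 ξ φ t ω, ξ.M1 t ω), ξ.W1 t ω))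
      (fun ω => (commonInfo ξ φ t ω, ξ.W0 t ω))
      ((κ ×ₖ modeKernel t).prodMkRight (Vec S.dX0) ×ₖ Kernel.const _ (S.πW1 t)) P :=
    hξ.hasCondDistrib_prodMk_rv (.w1 s) hHW (hXM.mono hle le_rfl) h₁
  have hXMW : Measurable fun ω => ((state1 ξ φ t ω, ξ.M1 t ω), ξ.W1 t ω) :=
    (hXM.mono (hξ.past_le _) le_rfl).prodMk (hξ.measurable (.w1 s))
  have h₃ := hasCondDistrib_comp_prodMk hXMW (hHW.mono (hξ.past_le _) le_rfl) h₂
    (f := fun a => localStep φ t (a.1.1, a.2))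
    (η := (predictKernel hφ ht κ).prodMkRight (Vec S.dX0))
    ((measurable_localStep hφ ht).comp (by fun_prop)) fun a => by
      rw [Kernel.prod_apply, Kernel.prodMkRight_apply, Kernel.prodMkRight_apply, Kernel.prod_apply]
      exact beliefUpdate_none_eq_map_localStep hφ ht (κ a.1) a.1
  convert h₃ using 2 with ω
  rw [state1_succ, localStep, ← commonInfo_m0 (φ := φ)]
  rfl

theorem hasCondDistrib_local_succ (hξ : ξ.Admissible P) (hφ : φ.IsMeasurable) (ht : t < S.T)
    (h : HasCondDistrib (fun ω => (state1 ξ φ t ω, ξ.M1 t ω)) (commonInfo ξ φ t)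
      (κ ×ₖ modeKernel t) P) :
    HasCondDistrib (fun ω => (state1 ξ φ (t + 1) ω, ξ.M1 (t + 1) ω)) (commonInfo ξ φ (t + 1))
      (updateKernel hφ ht.le κ ×ₖ modeKernel (t + 1)) P := by
  let s : Fin (S.T + 1) := ⟨t, Nat.lt_succ_of_lt ht⟩
  have hHW : Measurable[ξ.past (5 * (t + 1) + 2)] fun ω => (commonInfo ξ φ t ω, ξ.W0 t ω) :=
    ((measurable_past_commonInfo hφ ht.le).mono (Sources.past_mono (by omega)) le_rfl).prodMk
      (Sources.measurable_rv_past (i := .w0 s) (by simp only [Src.rank, s]; omega))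
  have hη_some (a : S.Hist t × Vec S.dX0) (m0 : Fin S.κ0) (x : Vec S.dX1) (m : Fin S.κ1) :
      (updateKernel hφ ht.le κ ×ₖ modeKernel (t + 1) : Kernel (S.Hist (t + 1)) _)
        (histStep φ t (a, m0, some x, some m)) = Measure.dirac (x, m) := by
    rw [← Measure.dirac_prod_dirac]
    exact Kernel.prod_apply _ _ _
  have hstep := hasCondDistrib_reception (η := updateKernel hφ ht.le κ ×ₖ modeKernel (t + 1)) hξ ht
    hHW (measurable_past_state1 hφ ht) (hasCondDistrib_state1_succ hξ hφ ht.le h)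
    (measurable_histStep hφ ht.le) (fun _ _ => Kernel.prod_apply _ _ _) hη_some
  rwa [← commonInfo_succ_eq_histStep] at hstep

theorem hasCondDistrib_local (hξ : ξ.Admissible P) (hφ : φ.IsMeasurable) (ht : t ≤ S.T) :
    HasCondDistrib (fun ω => (state1 ξ φ t ω, ξ.M1 t ω)) (commonInfo ξ φ t)
      (condDistrib (state1 ξ φ t) (commonInfo ξ φ t) P ×ₖ modeKernel t) P := by
  induction t with
  | zero => exact hasCondDistrib_condDistrib_prod (hasCondDistrib_local_zero hξ)
  | succ t ih =>
    exact hasCondDistrib_condDistrib_prod (hasCondDistrib_local_succ hξ hφ ht (ih (by omega)))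

theorem commonBelief_succ_ae_eq (hξ : ξ.Admissible P) (hφ : φ.IsMeasurable) (ht : t < S.T) :
    ∀ᵐ ω ∂P, commonBelief ξ φ P (t + 1) ω =
      updateKernel hφ ht.le (condDistrib (state1 ξ φ t) (commonInfo ξ φ t) P)
        (commonInfo ξ φ (t + 1) ω) :=
  ae_of_ae_map (hξ.measurable_commonInfo hφ ht).aemeasurable
    (condDistrib_ae_eq_of_hasCondDistrib_prod
      (hasCondDistrib_local_succ hξ hφ ht (hasCondDistrib_local hξ hφ ht.le)))

end Invariant

end System

namespace System

variable {S : System} {t : ℕ}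

section Noise

variable {Ω : Type*} {ξ : S.Sources Ω}

theorem Sources.future_anti : Antitone ξ.future := fun _ _ hmn =>
  biSup_mono fun _ hi => hmn.trans hi

/-- The primitive random variables that enter the loop between `(X¹_t, M¹_t)` and `H⁰_{t+1}`. -/
def Sources.noise (ξ : S.Sources Ω) (t : ℕ) (ω : Ω) :
    Vec S.dX0 × Vec S.dX1 × Fin S.κ0 × Fin S.κ1 × Bool :=
  (ξ.W0 t ω, ξ.W1 t ω, ξ.M0 (t + 1) ω, ξ.M1 (t + 1) ω, ξ.link (t + 1) ω)

theorem measurable_future_noise (ht : t < S.T) :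
    Measurable[ξ.future (5 * t + 5)] (ξ.noise t) := by
  let s : Fin (S.T + 1) := ⟨t, Nat.lt_succ_of_lt ht⟩
  let s' : Fin (S.T + 1) := ⟨t + 1, Nat.succ_lt_succ ht⟩
  have hfut (i : Src S.T) (hi : 5 * t + 5 ≤ i.rank) :
      Measurable[ξ.future (5 * t + 5)] (ξ.rv i) := Sources.measurable_rv_future hi
  exact (hfut (.w0 s) (by simp [Src.rank, s])).prodMk
    ((hfut (.w1 s) (by simp [Src.rank, s])).prodMk
      ((hfut (.m0 s') (by simp only [Src.rank, s']; omega)).prodMk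
        ((hfut (.m1 s') (by simp only [Src.rank, s']; omega)).prodMk
          (hfut (.link s') (by simp only [Src.rank, s']; omega)))))

variable [MeasurableSpace Ω] {P : Measure Ω}

theorem Sources.Admissible.future_le (hξ : ξ.Admissible P) (n : ℕ) :
    ξ.future n ≤ ‹MeasurableSpace Ω› :=
  iSup₂_le fun i _ => (hξ.measurable i).comap_le

variable [IsProbabilityMeasure P]

theorem Sources.Admissible.hasLaw_prodMk_rv (hξ : ξ.Admissible P) (i : Src S.T) {A : Type*}
    [MeasurableSpace A] {N : Ω → A} {ν : Measure A}
    (hN : Measurable[ξ.future (i.rank + 1)] N) (h : HasLaw N ν P) :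
    HasLaw (fun ω => (ξ.rv i ω, N ω)) ((S.srcLaw i).prod ν) P :=
  (indepFun_iff_hasLaw_prodMk_prod (hξ.hasLaw_rv i) h).1
    (hξ.indepFun_of_rank (i.rank + 1) (Sources.measurable_rv_past (Nat.lt_succ_self _)) hN)

theorem hasLaw_noise (hξ : ξ.Admissible P) (ht : t < S.T) :
    HasLaw (ξ.noise t) ((S.πW0 t).prod ((S.πW1 t).prod S.signalLaw)) P := by
  have : Fact (t ≤ S.T) := ⟨ht.le⟩
  let s : Fin (S.T + 1) := ⟨t, Nat.lt_succ_of_lt ht⟩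
  let s' : Fin (S.T + 1) := ⟨t + 1, Nat.succ_lt_succ ht⟩
  have hlink : Measurable[ξ.future ((Src.m1 s').rank + 1)] (ξ.link (t + 1)) :=
    Sources.measurable_rv_future (i := .link s') le_rfl
  have hM1 : Measurable[ξ.future ((Src.m0 s').rank + 1)]
      fun ω => (ξ.M1 (t + 1) ω, ξ.link (t + 1) ω) :=
    (Sources.measurable_rv_future (i := .m1 s') le_rfl).prodMk
      (hlink.mono (Sources.future_anti (Nat.le_succ _)) le_rfl)
  have hM0 : Measurable[ξ.future ((Src.w1 s).rank + 1)]
      fun ω => (ξ.M0 (t + 1) ω, ξ.M1 (t + 1) ω, ξ.link (t + 1) ω) :=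
    (Sources.measurable_rv_future (i := .m0 s') le_rfl).prodMk
      (hM1.mono (Sources.future_anti (Nat.le_succ _)) le_rfl)
  have hW1 : Measurable[ξ.future ((Src.w0 s).rank + 1)]
      fun ω => (ξ.W1 t ω, ξ.M0 (t + 1) ω, ξ.M1 (t + 1) ω, ξ.link (t + 1) ω) :=
    (Sources.measurable_rv_future (i := .w1 s) le_rfl).prodMk
      (hM0.mono (Sources.future_anti (Nat.le_succ _)) le_rfl)
  exact hξ.hasLaw_prodMk_rv (.w0 s) hW1 (hξ.hasLaw_prodMk_rv (.w1 s) hM0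
    (hξ.hasLaw_prodMk_rv (.m0 s') hM1 (hξ.hasLaw_prodMk_rv (.m1 s') hlink
      (hξ.hasLaw_rv (.link s')))))

end Noise

end System

namespace System

variable {S : System} {t : ℕ} {φ : S.Strategy}

section StepHist

/-- `h⁰_{t+1}` as a function of `(h⁰_t, (x¹_t, m¹_t), (w⁰_t, w¹_t, m⁰_{t+1}, m¹_{t+1}, γ_{t+1}))`
when `φ` is used. -/
def stepHist (φ : S.Strategy) (t : ℕ)
    (a : S.Hist t × (Vec S.dX1 × Fin S.κ1) ×
      (Vec S.dX0 × Vec S.dX1 × Fin S.κ0 × Fin S.κ1 × Bool)) : S.Hist (t + 1) :=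
  histStep φ t ((a.1, a.2.2.1), a.2.2.2.2.1,
    channel a.2.2.2.2.2.2 (localStep φ t (a.1, a.2.1, a.2.2.2.1)),
    channel a.2.2.2.2.2.2 a.2.2.2.2.2.1)

theorem measurable_stepHist (hφ : φ.IsMeasurable) (ht : t ≤ S.T) : Measurable (stepHist φ t) := by
  have hlocal : Measurable fun a : S.Hist t × (Vec S.dX1 × Fin S.κ1) ×
      (Vec S.dX0 × Vec S.dX1 × Fin S.κ0 × Fin S.κ1 × Bool) =>
        localStep φ t (a.1, a.2.1, a.2.2.2.1) :=
    (measurable_localStep hφ ht).comp (by fun_prop)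
  exact (measurable_histStep hφ ht).comp
    ((measurable_fst.prodMk measurable_snd.snd.fst).prodMk
      (measurable_snd.snd.snd.snd.fst.prodMk
        ((measurable_channel measurable_snd.snd.snd.snd.snd.snd hlocal).prodMk
          (measurable_channel measurable_snd.snd.snd.snd.snd.snd
            measurable_snd.snd.snd.snd.snd.fst))))

theorem commonInfo_succ_eq_stepHist {Ω : Type*} {ξ : S.Sources Ω} (ω : Ω) :
    commonInfo ξ φ (t + 1) ω =
      stepHist φ t (commonInfo ξ φ t ω, (state1 ξ φ t ω, ξ.M1 t ω), ξ.noise t ω) := by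
  refine (congrFun commonInfo_succ_eq_histStep ω).trans ?_
  rw [state1_succ, ← commonInfo_m0 (φ := φ) (t := t)]
  rfl

variable {V : S.ValueFn} {K : S.QuadraticValue} {κ : Kernel (S.Hist t) (Vec S.dX1)}
  [IsMarkovKernel κ]

theorem measurable_ext_updateKernel (hV : V.HasCoeffs K) (hφ : φ.IsMeasurable) (ht : t ≤ S.T) :
    Measurable fun h : S.Hist (t + 1) => V.ext h.x0 h.m0 (updateKernel hφ ht κ h) h.zTilde :=
  hV.measurable_ext measurable_histX0 measurable_histM0 _ measurable_zTilde

theorem ext_updateKernel_stepHist (hφ : φ.IsMeasurable) (ht : t ≤ S.T) (h : S.Hist t)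
    (s : Vec S.dX1 × Fin S.κ1 × Vec S.dX0 × Vec S.dX1) (i : Fin S.κ0 × Fin S.κ1 × Bool) :
    let h' := stepHist φ t (h, (s.1, s.2.1), (s.2.2.1, s.2.2.2, i))
    V.ext h'.x0 h'.m0 (updateKernel hφ ht κ h') h'.zTilde =
      V.ext (nextState0 h.x0 h.m0 (φ.act t h) (φ.presc t h) s) i.1
        (S.beliefUpdate t (κ h) (φ.act t h) (φ.presc t h) h.x0 h.m0 h.zTilde
          (channel i.2.2 (nextState1 h.x0 h.m0 (φ.act t h) (φ.presc t h) s)))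
        (channel i.2.2 i.2.1) := by
  intro h'
  rw [updateKernel_apply, nextState1, ← next1_eq]
  rfl

theorem lintegral_ext_updateKernel_stepHist (hV : V.HasCoeffs K) (hφ : φ.IsMeasurable)
    (ht : t ≤ S.T) (h : S.Hist t) :
    ∫⁻ a, (let h' := stepHist φ t (h, a)
        V.ext h'.x0 h'.m0 (updateKernel hφ ht κ h') h'.zTilde)
        ∂((κ h).prod (S.modeBelief h.zTilde)).prod
          ((S.πW0 t).prod ((S.πW1 t).prod S.signalLaw)) =
      S.stageNext t V h.x0 h.m0 (κ h) h.zTilde (φ.act t h) (φ.presc t h) := by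
  have : Fact (t ≤ S.T) := ⟨ht⟩
  let F (a) := V.ext (stepHist φ t (h, a)).x0 (stepHist φ t (h, a)).m0
    (updateKernel hφ ht κ (stepHist φ t (h, a))) (stepHist φ t (h, a)).zTilde
  have hF : Measurable F := (measurable_ext_updateKernel hV hφ ht).comp
    ((measurable_stepHist hφ ht).comp measurable_prodMk_left)
  calc ∫⁻ a, F a ∂((κ h).prod (S.modeBelief h.zTilde)).prod
          ((S.πW0 t).prod ((S.πW1 t).prod S.signalLaw))
      = ∫⁻ a, F ((a.1, a.2.1), a.2.2) ∂(κ h).prod ((S.modeBelief h.zTilde).prod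
          ((S.πW0 t).prod ((S.πW1 t).prod S.signalLaw))) := by
        rw [← Measure.prodAssoc_prod (μ := κ h), lintegral_map_equiv]
        rfl
    _ = ∫⁻ s, ∫⁻ i, F ((s.1, s.2.1), (s.2.2.1, s.2.2.2, i)) ∂S.signalLaw
          ∂S.plantLaw t (κ h) h.zTilde :=
        lintegral_prod_assoc (f := fun b => F ((b.1.1, b.1.2.1), (b.1.2.2.1, b.1.2.2.2, b.2)))
          _ _ _ _ _ (hF.comp (by fun_prop))
    _ = S.stageNext t V h.x0 h.m0 (κ h) h.zTilde (φ.act t h) (φ.presc t h) :=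
        lintegral_congr fun s => lintegral_congr fun i => ext_updateKernel_stepHist hφ ht h s i

end StepHist

section HistCost

/-- The instantaneous cost as a function of `(h⁰_t, (x¹_t, m¹_t))` when `φ` is used. -/
def histCost (φ : S.Strategy) (t : ℕ) (a : S.Hist t × Vec S.dX1 × Fin S.κ1) : ℝ≥0∞ :=
  ENNReal.ofReal (S.cost t a.1.x0 a.2.1 a.1.m0 a.2.2 (φ.act t a.1) (φ.presc t a.1 a.2))

theorem histCost_eq_costForm (h : S.Hist t) (b : Vec S.dX1 × Fin S.κ1) :
    histCost φ t (h, b) =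
      ENNReal.ofReal (S.costForm t h.m0 b.2 (stageVec h.x0 (φ.act t h) (φ.presc t h) b)) :=
  congrArg ENNReal.ofReal (cost_eq t h.m0 b.2 (stageVec h.x0 (φ.act t h) (φ.presc t h) b))

theorem measurable_histCost (hφ : φ.IsMeasurable) (ht : t ≤ S.T) : Measurable (histCost φ t) := by
  have hvec : Measurable fun a : S.Hist t × Vec S.dX1 × Fin S.κ1 =>
      stageVec a.1.x0 (φ.act t a.1) (φ.presc t a.1) a.2 :=
    ((measurable_histX0.comp measurable_fst).prodMk measurable_snd.fst).prodMk
      (((hφ.act t ht).comp measurable_fst).prodMk (hφ.presc t ht))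
  have hform := measurable_quadraticForm_apply (Function.uncurry (S.costForm t))
    ((measurable_histM0.comp measurable_fst).prodMk measurable_snd.snd) hvec
  have heq : histCost φ t = fun a =>
      ENNReal.ofReal (S.costForm t a.1.m0 a.2.2
        (stageVec a.1.x0 (φ.act t a.1) (φ.presc t a.1) a.2)) :=
    funext fun a => histCost_eq_costForm a.1 a.2
  exact heq ▸ hform.ennreal_ofReal

end HistCost

end System

section Telescoping

variable {M : Type*} [AddCommMonoid M] [PartialOrder M] [IsOrderedAddMonoid M] {v c : ℕ → M}
  {n : ℕ}

theorem le_sum_range_add (h : ∀ t < n, v t ≤ c t + v (t + 1)) :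
    v 0 ≤ ∑ t ∈ Finset.range n, c t + v n := by
  induction n with
  | zero => simp
  | succ n ih =>
    rw [Finset.sum_range_succ, add_assoc]
    exact (ih fun t ht => h t (Nat.lt_succ_of_lt ht)).trans
      (add_le_add_right (h n (Nat.lt_succ_self n)) _)

theorem sum_range_add_le (h : ∀ t < n, c t + v (t + 1) ≤ v t) :
    ∑ t ∈ Finset.range n, c t + v n ≤ v 0 :=
  le_sum_range_add (M := Mᵒᵈ) h

end Telescoping

namespace System

variable {S : System} {t : ℕ} {Ω : Type*} {ξ : S.Sources Ω} {φ : S.Strategy}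

/-- The instantaneous cost along the trajectory. -/
def pathCost (ξ : S.Sources Ω) (φ : S.Strategy) (t : ℕ) (ω : Ω) : ℝ≥0∞ :=
  ENNReal.ofReal (S.cost t (state0 ξ φ t ω) (state1 ξ φ t ω) (ξ.M0 t ω) (ξ.M1 t ω)
    (action0 ξ φ t ω) (action1 ξ φ t ω))

theorem pathCost_eq_histCost :
    pathCost ξ φ t = fun ω => histCost φ t (commonInfo ξ φ t ω, state1 ξ φ t ω, ξ.M1 t ω) := by
  funext ω
  rw [pathCost, histCost, commonInfo_m0]
  rfl

variable [MeasurableSpace Ω] {P : Measure Ω}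

theorem totalCost_eq_sum (hξ : ξ.Admissible P) (hφ : φ.IsMeasurable) :
    totalCost ξ φ P = ∑ t ∈ Finset.range (S.T + 1), ∫⁻ ω, pathCost ξ φ t ω ∂P := by
  refine lintegral_finsetSum (f := pathCost ξ φ) _ fun t ht => ?_
  have hle : t ≤ S.T := Nat.lt_succ_iff.1 (Finset.mem_range.1 ht)
  have hM1 : Measurable (ξ.M1 t) := hξ.measurable (.m1 ⟨t, Finset.mem_range.1 ht⟩)
  exact pathCost_eq_histCost (ξ := ξ) ▸ (measurable_histCost hφ hle).comp
    ((hξ.measurable_commonInfo hφ hle).prodMk ((hξ.measurable_state1 hφ hle).prodMk hM1))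

variable [IsProbabilityMeasure P] {V : ℕ → S.ValueFn}

instance (ω : Ω) : IsProbabilityMeasure (commonBelief ξ φ P t ω) := by
  unfold commonBelief
  infer_instance

/-- The value `V_t` along the trajectory. -/
def pathValue (ξ : S.Sources Ω) (φ : S.Strategy) (P : Measure Ω) [IsProbabilityMeasure P]
    (V : ℕ → S.ValueFn) (t : ℕ) (ω : Ω) : ℝ≥0∞ :=
  (V t).ext (commonInfo ξ φ t ω).x0 (commonInfo ξ φ t ω).m0 (commonBelief ξ φ P t ω)
    (commonInfo ξ φ t ω).zTilde

/-- The expression minimized in the definition of `V_t`, along the trajectory. -/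
def pathStageValue (ξ : S.Sources Ω) (φ : S.Strategy) (P : Measure Ω) [IsProbabilityMeasure P]
    (V : ℕ → S.ValueFn) (t : ℕ) (ω : Ω) : ℝ≥0∞ :=
  S.stageValue t (V (t + 1)) (commonInfo ξ φ t ω).x0 (commonInfo ξ φ t ω).m0
    (commonBelief ξ φ P t ω) (commonInfo ξ φ t ω).zTilde (φ.act t (commonInfo ξ φ t ω))
    (φ.presc t (commonInfo ξ φ t ω))

/-- The expected cost at time `t` given the common information, along the trajectory. -/
def pathStageCost (ξ : S.Sources Ω) (φ : S.Strategy) (P : Measure Ω) [IsProbabilityMeasure P]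
    (t : ℕ) (ω : Ω) : ℝ≥0∞ :=
  S.stageCost t (commonInfo ξ φ t ω).x0 (commonInfo ξ φ t ω).m0 (commonBelief ξ φ P t ω)
    (commonInfo ξ φ t ω).zTilde (φ.act t (commonInfo ξ φ t ω)) (φ.presc t (commonInfo ξ φ t ω))

/-- The expected cost to go from time `t + 1` on given the common information, along the
trajectory. -/
def pathStageNext (ξ : S.Sources Ω) (φ : S.Strategy) (P : Measure Ω) [IsProbabilityMeasure P]
    (V : ℕ → S.ValueFn) (t : ℕ) (ω : Ω) : ℝ≥0∞ :=
  S.stageNext t (V (t + 1)) (commonInfo ξ φ t ω).x0 (commonInfo ξ φ t ω).m0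
    (commonBelief ξ φ P t ω) (commonInfo ξ φ t ω).zTilde (φ.act t (commonInfo ξ φ t ω))
    (φ.presc t (commonInfo ξ φ t ω))

theorem ae_isBelief_commonBelief (hξ : ξ.Admissible P) (hφ : φ.IsMeasurable) (ht : t ≤ S.T)
    (hL : MemLp (state1 ξ φ t) 2 P) : ∀ᵐ ω ∂P, IsBelief (commonBelief ξ φ P t ω) := by
  have hcond := (hasCondDistrib_local hξ hφ ht).fst
  rw [Kernel.fst_prod] at hcond
  have hnorm : Measurable fun a : S.Hist t × Vec S.dX1 => ‖a.2‖ₑ ^ 2 := by fun_prop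
  have htower : ∫⁻ ω, ‖state1 ξ φ t ω‖ₑ ^ 2 ∂P =
      ∫⁻ ω, ∫⁻ x, ‖x‖ₑ ^ 2 ∂commonBelief ξ φ P t ω ∂P :=
    lintegral_comp_of_hasCondDistrib hcond hnorm
  have hfin : ∫⁻ ω, ‖state1 ξ φ t ω‖ₑ ^ 2 ∂P ≠ ∞ := by
    have h := eLpNorm_lt_top_iff_lintegral_rpow_enorm_lt_top (f := state1 ξ φ t) (μ := P)
      two_ne_zero ENNReal.ofNat_ne_top
    simp only [ENNReal.toReal_ofNat, ENNReal.rpow_ofNat] at h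
    exact (h.1 hL.2).ne
  have hmeas : Measurable fun ω => ∫⁻ x, ‖x‖ₑ ^ 2 ∂commonBelief ξ φ P t ω :=
    (hnorm.lintegral_kernel_prod_right'
      (κ := condDistrib (state1 ξ φ t) (commonInfo ξ φ t) P)).comp
      (hξ.measurable_commonInfo hφ ht)
  filter_upwards [ae_lt_top hmeas (htower ▸ hfin)] with ω hω
  exact (isBelief_iff_lintegral_lt_top _).2 hω

theorem pathStageCost_eq_lintegral_histCost :
    pathStageCost ξ φ P t = fun ω => ∫⁻ b, histCost φ t (commonInfo ξ φ t ω, b)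
      ∂(condDistrib (state1 ξ φ t) (commonInfo ξ φ t) P ×ₖ modeKernel t)
        (commonInfo ξ φ t ω) := by
  funext ω
  simp only [Kernel.prod_apply, histCost_eq_costForm]
  rfl

theorem measurable_pathStageCost (hξ : ξ.Admissible P) (hφ : φ.IsMeasurable) (ht : t ≤ S.T) :
    Measurable (pathStageCost ξ φ P t) := by
  rw [pathStageCost_eq_lintegral_histCost]
  exact (measurable_histCost hφ ht).lintegral_kernel_prod_right'.comp
    (hξ.measurable_commonInfo hφ ht)

theorem lintegral_pathCost (hξ : ξ.Admissible P) (hφ : φ.IsMeasurable) (ht : t ≤ S.T) :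
    ∫⁻ ω, pathCost ξ φ t ω ∂P = ∫⁻ ω, pathStageCost ξ φ P t ω ∂P := by
  rw [pathCost_eq_histCost, pathStageCost_eq_lintegral_histCost]
  exact lintegral_comp_of_hasCondDistrib (hasCondDistrib_local hξ hφ ht) (measurable_histCost hφ ht)

theorem hasCondDistrib_local_noise (hξ : ξ.Admissible P) (hφ : φ.IsMeasurable) (ht : t < S.T) :
    HasCondDistrib (fun ω => ((state1 ξ φ t ω, ξ.M1 t ω), ξ.noise t ω)) (commonInfo ξ φ t)
      ((condDistrib (state1 ξ φ t) (commonInfo ξ φ t) P ×ₖ modeKernel t) ×ₖ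
        Kernel.const _ ((S.πW0 t).prod ((S.πW1 t).prod S.signalLaw))) P := by
  have : Fact (t ≤ S.T) := ⟨ht.le⟩
  let s : Fin (S.T + 1) := ⟨t, Nat.lt_succ_of_lt ht⟩
  have hH := measurable_past_commonInfo (ξ := ξ) hφ ht.le
  have hXM : Measurable[ξ.past (5 * t + 5)] fun ω => (state1 ξ φ t ω, ξ.M1 t ω) :=
    ((measurable_past_state1 hφ ht.le).mono (Sources.past_mono (by omega)) le_rfl).prodMk
      (Sources.measurable_rv_past (i := .m1 s) (by simp only [Src.rank, s]; omega))
  have hN := measurable_future_noise (ξ := ξ) ht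
  exact hasCondDistrib_prodMk_of_indepFun (hXM.mono (hξ.past_le _) le_rfl)
    (hH.mono (hξ.past_le _) le_rfl) (hN.mono (hξ.future_le _) le_rfl)
    (hasCondDistrib_local hξ hφ ht.le) (hasLaw_noise hξ ht)
    (hξ.indepFun_of_rank (5 * t + 5) (hH.prodMk hXM) hN)

theorem lintegral_pathValue_succ (hξ : ξ.Admissible P) (hφ : φ.IsMeasurable) (ht : t < S.T)
    {K : S.QuadraticValue} (hV : (V (t + 1)).HasCoeffs K) :
    ∫⁻ ω, pathValue ξ φ P V (t + 1) ω ∂P = ∫⁻ ω, pathStageNext ξ φ P V t ω ∂P := by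
  have : Fact (t ≤ S.T) := ⟨ht.le⟩
  let κ := condDistrib (state1 ξ φ t) (commonInfo ξ φ t) P
  let F (h : S.Hist (t + 1)) : ℝ≥0∞ :=
    (V (t + 1)).ext h.x0 h.m0 (updateKernel hφ ht.le κ h) h.zTilde
  calc ∫⁻ ω, pathValue ξ φ P V (t + 1) ω ∂P
      = ∫⁻ ω, F (stepHist φ t (commonInfo ξ φ t ω,
          (state1 ξ φ t ω, ξ.M1 t ω), ξ.noise t ω)) ∂P := by
        refine lintegral_congr_ae ?_
        filter_upwards [commonBelief_succ_ae_eq hξ hφ ht] with ω hω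
        rw [pathValue, hω, commonInfo_succ_eq_stepHist]
    _ = ∫⁻ ω, ∫⁻ a, F (stepHist φ t (commonInfo ξ φ t ω, a))
          ∂((κ ×ₖ modeKernel t) ×ₖ Kernel.const _ ((S.πW0 t).prod ((S.πW1 t).prod S.signalLaw)))
            (commonInfo ξ φ t ω) ∂P :=
        lintegral_comp_of_hasCondDistrib (hasCondDistrib_local_noise hξ hφ ht)
          ((measurable_ext_updateKernel hV hφ ht.le).comp (measurable_stepHist hφ ht.le))
    _ = ∫⁻ ω, pathStageNext ξ φ P V t ω ∂P := by
        refine lintegral_congr fun ω => ?_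
        rw [Kernel.prod_apply, Kernel.prod_apply]
        exact lintegral_ext_updateKernel_stepHist hV hφ ht.le _

theorem lintegral_pathStageValue (hξ : ξ.Admissible P) (hφ : φ.IsMeasurable) (ht : t < S.T)
    (hV : S.SolvesDP V) :
    ∫⁻ ω, pathStageValue ξ φ P V t ω ∂P =
      ∫⁻ ω, pathCost ξ φ t ω ∂P + ∫⁻ ω, pathValue ξ φ P V (t + 1) ω ∂P := by
  have : Fact (t ≤ S.T) := ⟨ht.le⟩
  obtain ⟨K, hK⟩ := hV.exists_hasCoeffs (Nat.le_succ_of_le ht)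
  rw [lintegral_pathCost hξ hφ ht.le, lintegral_pathValue_succ hξ hφ ht hK,
    ← lintegral_add_left (measurable_pathStageCost hξ hφ ht.le)]
  exact lintegral_congr fun ω => stageValue_eq_add hK (hφ.presc_apply ht.le _)

theorem lintegral_pathStageValue_last (hξ : ξ.Admissible P) (hφ : φ.IsMeasurable)
    (hL : MemLp (state1 ξ φ S.T) 2 P) (hV : S.SolvesDP V) :
    ∫⁻ ω, pathStageValue ξ φ P V S.T ω ∂P = ∫⁻ ω, pathCost ξ φ S.T ω ∂P := by
  have : Fact (S.T ≤ S.T) := ⟨le_rfl⟩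
  rw [lintegral_pathCost hξ hφ le_rfl]
  refine lintegral_congr_ae ?_
  filter_upwards [ae_isBelief_commonBelief hξ hφ le_rfl hL] with ω hω
  exact stageValue_eq_stageCost hV.terminal hω (hφ.presc_apply le_rfl _)

theorem lintegral_pathValue_le_lintegral_pathStageValue (hξ : ξ.Admissible P)
    (hφ : Feasible ξ φ P) (hV : S.SolvesDP V) (ht : t ≤ S.T) :
    ∫⁻ ω, pathValue ξ φ P V t ω ∂P ≤ ∫⁻ ω, pathStageValue ξ φ P V t ω ∂P := by
  have : Fact (t ≤ S.T) := ⟨ht⟩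
  refine lintegral_mono_ae ?_
  filter_upwards [ae_isBelief_commonBelief hξ hφ.isMeasurable ht (hφ.memLp_state1 t ht)] with ω hω
  exact hV.ext_le_stageValue hω (hφ.isMeasurable.presc_apply ht _)

theorem lintegral_pathValue_eq_lintegral_pathStageValue (hξ : ξ.Admissible P)
    (hφ : Feasible ξ φ P) (hmin : AchievesMin ξ φ P V) (ht : t ≤ S.T) :
    ∫⁻ ω, pathValue ξ φ P V t ω ∂P = ∫⁻ ω, pathStageValue ξ φ P V t ω ∂P := by
  refine lintegral_congr_ae ?_
  filter_upwards [ae_isBelief_commonBelief hξ hφ.isMeasurable ht (hφ.memLp_state1 t ht),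
    hmin t ht] with ω hω hmin
  obtain ⟨qb, -, qt, -, hpresc, hvalue⟩ := hmin hω
  rw [pathStageValue, hpresc]
  exact (V t).ext_eq_of_coe_eq hvalue.symm

theorem lintegral_pathValue_le_totalCost (hξ : ξ.Admissible P) (hφ : Feasible ξ φ P)
    (hV : S.SolvesDP V) : ∫⁻ ω, pathValue ξ φ P V 0 ω ∂P ≤ totalCost ξ φ P := by
  have hstage (t : ℕ) (ht : t ≤ S.T) :=
    lintegral_pathValue_le_lintegral_pathStageValue hξ hφ hV ht
  rw [totalCost_eq_sum hξ hφ.isMeasurable, Finset.sum_range_succ,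
    ← lintegral_pathStageValue_last hξ hφ.isMeasurable (hφ.memLp_state1 _ le_rfl) hV]
  refine (le_sum_range_add (v := fun t => ∫⁻ ω, pathValue ξ φ P V t ω ∂P)
    (c := fun t => ∫⁻ ω, pathCost ξ φ t ω ∂P) fun t ht => ?_).trans
    (add_le_add_right (hstage S.T le_rfl) _)
  exact (hstage t ht.le).trans_eq (lintegral_pathStageValue hξ hφ.isMeasurable ht hV)

theorem totalCost_eq_lintegral_pathValue (hξ : ξ.Admissible P) (hφ : Feasible ξ φ P)
    (hV : S.SolvesDP V) (hmin : AchievesMin ξ φ P V) :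
    totalCost ξ φ P = ∫⁻ ω, pathValue ξ φ P V 0 ω ∂P := by
  have hstage (t : ℕ) (ht : t ≤ S.T) :=
    lintegral_pathValue_eq_lintegral_pathStageValue hξ hφ hmin ht
  refine le_antisymm ?_ (lintegral_pathValue_le_totalCost hξ hφ hV)
  rw [totalCost_eq_sum hξ hφ.isMeasurable, Finset.sum_range_succ,
    ← lintegral_pathStageValue_last hξ hφ.isMeasurable (hφ.memLp_state1 _ le_rfl) hV,
    ← hstage S.T le_rfl]
  refine sum_range_add_le (v := fun t => ∫⁻ ω, pathValue ξ φ P V t ω ∂P)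
    (c := fun t => ∫⁻ ω, pathCost ξ φ t ω ∂P) fun t ht => ?_
  rw [hstage t ht.le, lintegral_pathStageValue hξ hφ.isMeasurable ht hV]

end System

end SwitchedNCS

end

theorem theorem2 {Ω : Type*} [MeasurableSpace Ω] (P : Measure Ω) [IsProbabilityMeasure P]
    (S : System) (ξ : S.Sources Ω) (hξ : ξ.Admissible P)
    (V : ℕ → S.ValueFn) (hV : S.SolvesDP V)
    (φ : S.Strategy) (hφ : System.Feasible ξ φ P)
    (hmin : System.AchievesMin ξ φ P V) :
    System.IsOptimal ξ φ P :=
  ⟨hφ, fun _ hφ' => (System.totalCost_eq_lintegral_pathValue hξ hφ hV hmin).trans_le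
    (System.lintegral_pathValue_le_totalCost hξ hφ' hV)⟩
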